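/- Let $\Sigma$ be a fixed finite alphabet and let $\lambda$ denote the empty word. *Patterns* are given by $P ::= \varepsilon \mid \sigma \mid P_1+P_2 \mid P_1\cdot P_2 \mid P_1^*$ with $\sigma\in\Sigma$. *Nodes* are words over $\{1,2\}$; the nodes of a pattern $P$ are the addresses in its syntax tree (the root is $\lambda$, the children of $n$ are $n1$ and $n2$), and a node of $P$ is *bindable* if none of its proper ancestors is labelled $*$. Write $\mathrm{bn}(P)$ for the set of bindable nodes. An *association* for $P$ is a map $V$ from $\mathrm{bn}(P)$ to $\Sigma^*\cup\{\bot\}$. Write $[\lambda\to w]$ for the map with domain $\{\lambda\}$ and value $w$. Define $V_1+P_2$ by $\lambda\mapsto V_1(\lambda)$, $1n\mapsto V_1(n)$, $2n\mapsto\bot$; define $P_1+V_2$ by $\lambda\mapsto V_2(\lambda)$, $1n\mapsto\bot$, $2n\mapsto V_2(n)$; and define $V_1\cdot V_2$ by $\lambda\mapsto V_1(\lambda)V_2(\lambda)$ (or $\bot$ if one of these is $\bot$), $1n\mapsto V_1(n)$, $2n\mapsto V_2(n)$. The matching relation $w\in P\leadsto V$ and the auxiliary relation $(w_1,w_2)\in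 P_1\cdot P_2\leadsto(V_1,V_2)$ are defined by the following rules, by recursion on patterns, where $w\in P$ means that $w\in P\leadsto V$ for some $V$: - $\lambda\in\varepsilon\leadsto[\lambda\to\lambda]$; $\ \sigma\in\sigma\leadsto[\lambda\to\sigma]$; $\ \lambda\in P^*\leadsto[\lambda\to\lambda]$; - if $w_1\in P\leadsto V_1$, $w_2\in P^*\leadsto V_2$ and $w_1\neq\lambda$, then $w_1w_2\in P^*\leadsto[\lambda\to w_1w_2]$; - if $w\in P_1\leadsto V$, then $w\in P_1+P_2\leadsto V+P_2$; - if $w\in P_2\leadsto V$ and $w\notin P_1$, then $w\in P_1+P_2\leadsto P_1+V$ (first match); - if $(w_1,w_2)\in P_1\cdot P_2\leadsto(V_1,V_2)$, then $w_1w_2\in P_1\cdot P_2\leadsto V_1\cdot V_2$; - if $w\in P\leadsto V_2$, then $(\lambda,w)\in\varepsilon\cdot P\leadsto([\lambda\to\lambda],V_2)$; - if $\sigma\in\sigma\leadsto V_1$ and $w\in P\leadsto V_2$, then $(\sigma,w)\in\sigma\cdot P\leadsto(V_1,V_2)$; - if $(w_1,w_2)\in P_1\cdot P_3\leadsto(V_1,V_2)$,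 then $(w_1,w_2)\in(P_1+P_2)\cdot P_3\leadsto(V_1+P_2,V_2)$; - if $(w_1,w_2)\in P_2\cdot P_3\leadsto(V_1,V_2)$ and $w_1w_2\notin P_1\cdot P_3$, then $(w_1,w_2)\in(P_1+P_2)\cdot P_3\leadsto(P_1+V_1,V_2)$ (first match); - if $(w_1,w_2w_3)\in P_1\cdot(P_2\cdot P_3)\leadsto(V_1,W)$ and $(w_2,w_3)\in P_2\cdot P_3\leadsto(V_2,V_3)$, then $(w_1w_2,w_3)\in(P_1\cdot P_2)\cdot P_3\leadsto(V_1\cdot V_2,V_3)$; - if $w_1\in P_1^*\leadsto V_1$, $w_2\in P_2\leadsto V_2$, and there are no $w_3\neq\lambda$ and $w_4$ with $w_2=w_3w_4$, $w_1w_3\in P_1^*$ and $w_4\in P_2$, then $(w_1,w_2)\in P_1^*\cdot P_2\leadsto(V_1,V_2)$ (longest match). For a language $C\subseteq\Sigma^*$, a pattern $P$ and $n\in\mathrm{bn}(P)$, the *type* of $n$ in $P$ relative to $C$ is $$T(n,P,C)=\{\,w\in\Sigma^* \mid \text{there are } w'\in C \text{ and } V \text{ with } w'\in P\leadsto V \text{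 and } V(n)=w\,\}.$$ **Theorem.** If $C$ is regular, then $T(n,P,C)$ is regular for every pattern $P$ and every bindable node $n$ of $P$. Moreover it can be effectively computed: there is an algorithm (a computable function) that, given $P$, $n\in\mathrm{bn}(P)$ and a finite automaton recognizing $C$, outputs a finite automaton recognizing $T(n,P,C)$. -/

import Mathlib

namespace UniqueMatching

/-- Regular expression patterns over the alphabet `α`. -/
inductive Pattern (α : Type*) where
  | eps : Pattern α
  | sym (a : α) : Pattern α
  | alt (P₁ P₂ : Pattern α) : Pattern α
  | cat (P₁ P₂ : Pattern α) : Pattern α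
  | star (P₁ : Pattern α) : Pattern α

/-- The node labels `{*, ·, +, ε} ∪ α`. -/
inductive Label (α : Type*) where
  | star : Label α
  | cat : Label α
  | alt : Label α
  | eps : Label α
  | sym (a : α) : Label α

/-- Nodes are words over `{1, 2}`; `false` stands for `1` (first child) and `true` for `2`
(second child). -/
abbrev Node := List Bool

namespace Pattern

variable {α : Type*}

/-- The pattern as a partial function from nodes to labels (its abstract syntax tree);
`none` means undefined. -/
def label : Pattern α → Node → Option (Label α)
  | eps, [] => some Label.eps
  | sym a, [] => some (Label.sym a)
  | alt _ _, [] => some Label.alt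
  | alt P₁ _, false :: n => P₁.label n
  | alt _ P₂, true :: n => P₂.label n
  | cat _ _, [] => some Label.cat
  | cat P₁ _, false :: n => P₁.label n
  | cat _ P₂, true :: n => P₂.label n
  | star _, [] => some Label.star
  | star P₁, false :: n => P₁.label n
  | _, _ => none

/-- The set of nodes of the syntax tree. -/
def dom (P : Pattern α) : Set Node := {n | (P.label n).isSome}

/-- Bindable nodes: nodes without a (proper) ancestor labelled `*`. -/
def bn (P : Pattern α) : Set Node :=
  {m | m ∈ P.dom ∧ ∀ n n' : Node, n' ≠ [] → m = n ++ n' → P.label n ≠ some Label.star}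

/-- The number of nodes of the syntax tree. -/
def size : Pattern α → ℕ
  | eps => 1
  | sym _ => 1
  | alt P₁ P₂ => P₁.size + P₂.size + 1
  | cat P₁ P₂ => P₁.size + P₂.size + 1
  | star P₁ => P₁.size + 1

/-- The pattern written as a string of labels in prefix (Polish) notation. -/
def code : Pattern α → List (Label α)
  | eps => [Label.eps]
  | sym a => [Label.sym a]
  | alt P₁ P₂ => Label.alt :: (P₁.code ++ P₂.code)
  | cat P₁ P₂ => Label.cat :: (P₁.code ++ P₂.code)
  | star P₁ => Label.star :: P₁.code

end Pattern

/-- Associations: functions from nodes to words or `⊥` (`none`). An association for a pattern `P`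
is a function on the bindable nodes of `P`; it is extended by `⊥` to all other nodes. -/
abbrev Assoc (α : Type*) := Node → Option (List α)

namespace Assoc

variable {α : Type*}

/-- `[λ → w]`. -/
def single (w : List α) : Assoc α
  | [] => some w
  | _ :: _ => none

/-- `V + P₂`. -/
def altLeft (V : Assoc α) : Assoc α
  | [] => V []
  | false :: n => V n
  | true :: _ => none

/-- `P₁ + V`. -/
def altRight (V : Assoc α) : Assoc α
  | [] => V []
  | false :: _ => none
  | true :: n => V n

/-- `V₁ · V₂`. -/
def cat (V₁ V₂ : Assoc α) : Assoc α
  | [] =>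
    match V₁ [], V₂ [] with
    | some w₁, some w₂ => some (w₁ ++ w₂)
    | _, _ => none
  | false :: n => V₁ n
  | true :: n => V₂ n

end Assoc

/-- The two rules (empty word, closure) for matching against `P*`, where `R` is the matching
relation of `P`. -/
inductive StarMatch {α : Type*} (R : List α → Assoc α → Prop) : List α → Assoc α → Prop
  | empty : StarMatch R [] (Assoc.single [])
  | closure {w₁ w₂ : List α} {V₁ V₂ : Assoc α} :
      R w₁ V₁ → StarMatch R w₂ V₂ → w₁ ≠ [] → StarMatch R (w₁ ++ w₂) (Assoc.single (w₁ ++ w₂))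

/- The matching relation with first match and longest match policy. The inference rules have
negative premises, which only concern smaller patterns; so the relation is defined by recursion on
the pattern, with one clause (or disjunct) for each rule. -/
mutual

/-- `Match P w V`: the word `w` is matched by `P`, yielding the associations `V`. -/
def Match {α : Type*} : Pattern α → List α → Assoc α → Prop
  | .eps => fun w V => w = [] ∧ V = Assoc.single []
  | .sym a => fun w V => w = [a] ∧ V = Assoc.single [a]
  | .star P => StarMatch (fun w V => Match P w V)
  | .alt P₁ P₂ => fun w V =>
      (∃ V₁, Match P₁ w V₁ ∧ V = V₁.altLeft) ∨
      (∃ V₂, Match P₂ w V₂ ∧ (¬ ∃ U, Match P₁ w U) ∧ V = V₂.altRight)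
  | .cat P₁ P₂ => fun w V =>
      ∃ w₁ w₂ V₁ V₂, MatchPair P₁ P₂ w₁ w₂ V₁ V₂ ∧ w = w₁ ++ w₂ ∧ V = V₁.cat V₂
termination_by P => (P.size, P.size)
decreasing_by all_goals simp [Prod.lex_def, Pattern.size]; try omega

/-- `MatchPair P₁ P₂ w₁ w₂ V₁ V₂`: when `w₁ ++ w₂` is matched by `P₁ · P₂`, the pattern `P₁` is
responsible for `w₁`, yielding `V₁`, and `P₂` is responsible for `w₂`, yielding `V₂`. -/
def MatchPair {α : Type*} :
    Pattern α → Pattern α → List α → List α → Assoc α → Assoc α → Prop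
  | .eps, P => fun w₁ w₂ V₁ V₂ => w₁ = [] ∧ V₁ = Assoc.single [] ∧ Match P w₂ V₂
  | .sym a, P => fun w₁ w₂ V₁ V₂ => w₁ = [a] ∧ Match (.sym a) [a] V₁ ∧ Match P w₂ V₂
  | .alt P₁ P₂, P₃ => fun w₁ w₂ V₁ V₂ =>
      (∃ U, MatchPair P₁ P₃ w₁ w₂ U V₂ ∧ V₁ = U.altLeft) ∨
      (∃ U, MatchPair P₂ P₃ w₁ w₂ U V₂ ∧ (¬ ∃ W, Match (.cat P₁ P₃) (w₁ ++ w₂) W) ∧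
        V₁ = U.altRight)
  | .cat P₁ P₂, P₃ => fun w w₃ V V₃ =>
      ∃ w₁ w₂ V₁ V₂ W, MatchPair P₁ (.cat P₂ P₃) w₁ (w₂ ++ w₃) V₁ W ∧
        MatchPair P₂ P₃ w₂ w₃ V₂ V₃ ∧ w = w₁ ++ w₂ ∧ V = V₁.cat V₂
  | .star P₁, P₂ => fun w₁ w₂ V₁ V₂ =>
      Match (.star P₁) w₁ V₁ ∧ Match P₂ w₂ V₂ ∧
      ¬ ∃ w₃ w₄, w₃ ≠ [] ∧ w₂ = w₃ ++ w₄ ∧ (∃ U, Match (.star P₁) (w₁ ++ w₃) U) ∧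
        (∃ U, Match P₂ w₄ U)
termination_by P₁ P₂ => (P₁.size + P₂.size + 1, P₁.size)
decreasing_by all_goals simp [Prod.lex_def, Pattern.size]; try omega

end

/-- The type of node `n` in `P` relative to the context `C`. -/
def typeOf {α : Type*} (n : Node) (P : Pattern α) (C : Language α) : Language α :=
  {w | ∃ w' ∈ C, ∃ V, Match P w' V ∧ V n = some w}

/-- Explicit finite descriptions of nondeterministic finite automata: the states are named by
natural numbers, and the initial states, the final states and the transitions are listed. -/
structure FinAut (α : Type*) where
  init : List ℕ
  final : List ℕ
  trans : List (ℕ × α × ℕ)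

namespace FinAut

variable {α : Type*}

/-- The described automaton. -/
def toNFA (A : FinAut α) : NFA α ℕ where
  step q a := {q' | (q, a, q') ∈ A.trans}
  start := {q | q ∈ A.init}
  accept := {q | q ∈ A.final}

/-- The language recognized by the automaton. -/
def language (A : FinAut α) : Language α := A.toNFA.accepts

/-- Descriptions of automata are triples of lists. -/
def equivProd (α : Type*) : FinAut α ≃ List ℕ × List ℕ × List (ℕ × α × ℕ) where
  toFun A := (A.init, A.final, A.trans)
  invFun x := ⟨x.1, x.2.1, x.2.2⟩
  left_inv _ := rfl
  right_inv _ := rfl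

instance [Primcodable α] : Primcodable (FinAut α) := Primcodable.ofEquiv _ (equivProd α)

end FinAut

namespace Label

/-- Labels are four special symbols or letters. -/
def equivSum (α : Type*) : Label α ≃ Fin 4 ⊕ α where
  toFun
    | star => .inl 0
    | cat => .inl 1
    | alt => .inl 2
    | eps => .inl 3
    | sym a => .inr a
  invFun
    | .inl 0 => star
    | .inl 1 => cat
    | .inl 2 => alt
    | .inl 3 => eps
    | .inr a => sym a
  left_inv l := by cases l <;> rfl
  right_inv x := by
    rcases x with i | a
    · fin_cases i <;> rfl
    · rfl

instance {α : Type*} [Primcodable α] : Primcodable (Label α) := Primcodable.ofEquiv _ (equivSum α)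

end Label

end UniqueMatching

-- In the rules for a concatenation, the right-hand pattern matters only through the set of words it
-- matches. That set is its ordinary regular language, because the policies choose between
-- factorizations without losing words. So a pattern can be parsed in front of an arbitrary
-- continuation language `K` (`Parse`), and matching is parsing with `K = 1` (`match_iff_parse`).
--
-- Regularity rests on finite-index congruences on words (`Coloring`). A congruence is refined by
-- recording, for each word, the colours of the outer parts of its factorizations a·m·b with m in
-- the closure of a union of classes (`refine`). Words of equal refined colour have corresponding
-- factorizations, so products and closures of respected languages are respected one refinement
-- later. By induction on the pattern, after enough refinements a binding of u inside x·u·v survives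
-- replacing x, u, v by words of the same colours (`exists_context_of_binds`). The negative
-- conditions survive too, since a violating factorization can be carried back. Starting from the
-- state transformations of an automaton for `C`, the type becomes a union of classes of a finite
-- congruence, hence regular.
--
-- For effectivity, the number N of colours is an explicit primitive recursive function of the
-- input, and every word shares its colour with one of length at most N (`exists_short`). So a word
-- in the type has a witness with at most N letters added on either side, and short words can be
-- tested by exhaustive tables (`mem_typeWords`). The words of the type of length at most 2N + 1
-- then determine an automaton for it (`language_residualAut`).

namespace UniqueMatching

open scoped Computability

universe u

variable {α : Type u}

-- Parsing in front of a continuation language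

namespace Pattern

/-- The regular language denoted by a pattern, irrespective of the matching policy. -/
def lang : Pattern α → Language α
  | eps => 1
  | sym a => {[a]}
  | alt P₁ P₂ => P₁.lang + P₂.lang
  | cat P₁ P₂ => P₁.lang * P₂.lang
  | star P₁ => P₁.lang∗

end Pattern

/-- `Parse P K w₁ w₂ V`: in the word `w₁ ++ w₂`, to be matched by `P` followed by a word of `K`,
the pattern `P` is responsible for `w₁`, yielding `V`. -/
def Parse : Pattern α → Language α → List α → List α → Assoc α → Prop
  | .eps, K, w₁, w₂, V => w₁ = [] ∧ V = Assoc.single [] ∧ w₂ ∈ K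
  | .sym a, K, w₁, w₂, V => w₁ = [a] ∧ V = Assoc.single [a] ∧ w₂ ∈ K
  | .alt P₁ P₂, K, w₁, w₂, V =>
      (∃ U, Parse P₁ K w₁ w₂ U ∧ V = U.altLeft) ∨
      (∃ U, Parse P₂ K w₁ w₂ U ∧ w₁ ++ w₂ ∉ P₁.lang * K ∧ V = U.altRight)
  | .cat P₁ P₂, K, w₁, w₂, V =>
      ∃ a b V₁ V₂, Parse P₁ (P₂.lang * K) a (b ++ w₂) V₁ ∧ Parse P₂ K b w₂ V₂ ∧
        w₁ = a ++ b ∧ V = V₁.cat V₂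
  | .star P, K, w₁, w₂, V =>
      w₁ ∈ P.lang∗ ∧ V = Assoc.single w₁ ∧ w₂ ∈ K ∧
      ¬ ∃ w₃ w₄, w₃ ≠ [] ∧ w₂ = w₃ ++ w₄ ∧ w₁ ++ w₃ ∈ P.lang∗ ∧ w₄ ∈ K

theorem Parse.mem {P : Pattern α} {K : Language α} {w₁ w₂ : List α} {V : Assoc α}
    (h : Parse P K w₁ w₂ V) : w₁ ∈ P.lang ∧ w₂ ∈ K := by
  induction P generalizing K w₁ w₂ V with
  | eps => exact ⟨h.1, h.2.2⟩
  | sym a => exact ⟨h.1, h.2.2⟩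
  | star P _ => exact ⟨h.1, h.2.2.1⟩
  | alt P₁ P₂ ih₁ ih₂ =>
    rcases h with ⟨U, h, -⟩ | ⟨U, h, -⟩
    · exact ⟨.inl (ih₁ h).1, (ih₁ h).2⟩
    · exact ⟨.inr (ih₂ h).1, (ih₂ h).2⟩
  | cat P₁ P₂ ih₁ ih₂ =>
    obtain ⟨a, b, V₁, V₂, h₁, h₂, rfl, -⟩ := h
    exact ⟨Language.append_mem_mul (ih₁ h₁).1 (ih₂ h₂).1, (ih₂ h₂).2⟩

theorem Parse.nil {P : Pattern α} {K : Language α} {w₁ w₂ : List α} {V : Assoc α}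
    (h : Parse P K w₁ w₂ V) : V [] = some w₁ := by
  induction P generalizing K w₁ w₂ V with
  | eps => obtain ⟨rfl, rfl, -⟩ := h; rfl
  | sym a => obtain ⟨rfl, rfl, -⟩ := h; rfl
  | star P _ => obtain ⟨-, rfl, -⟩ := h; rfl
  | alt P₁ P₂ ih₁ ih₂ =>
    rcases h with ⟨U, h, rfl⟩ | ⟨U, h, -, rfl⟩
    · exact (show U.altLeft [] = U [] from rfl) ▸ ih₁ h
    · exact (show U.altRight [] = U [] from rfl) ▸ ih₂ h
  | cat P₁ P₂ ih₁ ih₂ =>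
    obtain ⟨a, b, V₁, V₂, h₁, h₂, rfl, rfl⟩ := h
    simp [Assoc.cat, ih₁ h₁, ih₂ h₂]

/-- The policies never cost a word: the first alternative is taken whenever it leads to any
factorization, and among the finitely many prefixes available to a star there is a longest. -/
theorem exists_parse {P : Pattern α} {K : Language α} {w : List α} (h : w ∈ P.lang * K) :
    ∃ w₁ w₂ V, w = w₁ ++ w₂ ∧ Parse P K w₁ w₂ V := by
  induction P generalizing K w with
  | eps =>
    obtain ⟨a, ha, b, hb, rfl⟩ := h
    exact ⟨a, b, _, rfl, ha, rfl, hb⟩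
  | sym a =>
    obtain ⟨a, ha, b, hb, rfl⟩ := h
    exact ⟨a, b, _, rfl, ha, rfl, hb⟩
  | alt P₁ P₂ ih₁ ih₂ =>
    by_cases h₁ : w ∈ P₁.lang * K
    · obtain ⟨w₁, w₂, V, rfl, hV⟩ := ih₁ h₁
      exact ⟨w₁, w₂, _, rfl, .inl ⟨V, hV, rfl⟩⟩
    · obtain ⟨a, ha | ha, b, hb, rfl⟩ := h
      · exact absurd (Language.append_mem_mul ha hb) h₁
      · obtain ⟨w₁, w₂, V, hw, hV⟩ := ih₂ (Language.append_mem_mul ha hb)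
        exact ⟨w₁, w₂, _, hw, .inr ⟨V, hV, hw ▸ h₁, rfl⟩⟩
  | cat P₁ P₂ ih₁ ih₂ =>
    rw [Pattern.lang, mul_assoc] at h
    obtain ⟨a, r, V₁, rfl, h₁⟩ := ih₁ h
    obtain ⟨b, w₂, V₂, rfl, h₂⟩ := ih₂ h₁.mem.2
    exact ⟨a ++ b, w₂, _, by simp, a, b, V₁, V₂, h₁, h₂, rfl, rfl⟩
  | star P _ =>
    classical
    -- Longest match: maximize the length of the starred prefix among the factorizations whose rest
    -- lies in `K`.
    let p : ℕ → Prop := fun n => ∃ w₁ w₂, w = w₁ ++ w₂ ∧ w₁ ∈ P.lang∗ ∧ w₂ ∈ K ∧ w₁.length = n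
    obtain ⟨a, ha, b, hb, hw⟩ := h
    have hp : p a.length := ⟨a, b, hw.symm, ha, hb, rfl⟩
    have hle : a.length ≤ w.length := by rw [← hw]; simp
    obtain ⟨w₁, w₂, rfl, h₁, h₂, hn⟩ := Nat.findGreatest_spec hle hp
    refine ⟨w₁, w₂, _, rfl, h₁, rfl, h₂, ?_⟩
    rintro ⟨w₃, w₄, h₃, rfl, h₄, h₅⟩
    have hq : p (w₁ ++ w₃).length := ⟨_, w₄, by simp, h₄, h₅, rfl⟩
    have := Nat.le_findGreatest (P := p) (n := (w₁ ++ (w₃ ++ w₄)).length) (by simp) hq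
    have hpos := List.length_pos_iff.2 h₃
    rw [← hn, List.length_append] at this
    omega

theorem mem_lang_iff_exists_parse {P : Pattern α} {w : List α} :
    w ∈ P.lang ↔ ∃ V, Parse P 1 w [] V := by
  constructor
  · intro h
    rw [← mul_one P.lang] at h
    obtain ⟨w₁, w₂, V, rfl, hV⟩ := exists_parse h
    obtain rfl := (Language.mem_one _).1 hV.mem.2
    exact ⟨V, by simpa using hV⟩
  · rintro ⟨V, h⟩
    exact h.mem.1

theorem starMatch_iff {P : Pattern α} {R : List α → Assoc α → Prop}
    (hR : ∀ w, (∃ V, R w V) ↔ w ∈ P.lang) {w : List α} {V : Assoc α} :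
    StarMatch R w V ↔ w ∈ P.lang∗ ∧ V = Assoc.single w := by
  constructor
  · intro h
    induction h with
    | empty => exact ⟨Language.nil_mem_kstar _, rfl⟩
    | closure h₁ _ _ ih =>
      refine ⟨?_, rfl⟩
      rw [← Language.one_add_self_mul_kstar_eq_kstar]
      exact .inr (Language.append_mem_mul ((hR _).1 ⟨_, h₁⟩) ih.1)
  · rintro ⟨h, rfl⟩
    obtain ⟨L, rfl, hL⟩ := Language.mem_kstar_iff_exists_nonempty.1 h
    clear h
    induction L with
    | nil => exact .empty
    | cons x L ih =>
      obtain ⟨V, hV⟩ := (hR x).2 (hL x (by simp)).1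
      exact .closure hV (ih fun y hy => hL y (by simp [hy])) (hL x (by simp)).2

/-- The hypothesis on `Q`, that it matches exactly its language, is stable under passing from `Q` to
`P₂.cat Q`. This makes induction on `P` alone sufficient, although the rule for a nested
concatenation enlarges the right-hand pattern. -/
theorem match_and_matchPair_iff (P : Pattern α) :
    (∀ w V, Match P w V ↔ Parse P 1 w [] V) ∧
    ∀ Q : Pattern α, (∀ w, (∃ V, Match Q w V) ↔ w ∈ Q.lang) → ∀ w₁ w₂ V₁ V₂,
      MatchPair P Q w₁ w₂ V₁ V₂ ↔ Parse P Q.lang w₁ w₂ V₁ ∧ Match Q w₂ V₂ := by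
  induction P with
  | eps =>
    constructor
    · intro w V
      simp [Match, Parse]
    · intro Q hQ w₁ w₂ V₁ V₂
      simp only [MatchPair, Parse]
      have := hQ w₂
      grind
  | sym a =>
    constructor
    · intro w V
      simp [Match, Parse]
    · intro Q hQ w₁ w₂ V₁ V₂
      simp only [MatchPair, Parse, Match]
      have := hQ w₂
      grind
  | star P ih =>
    have h : ∀ w V, Match (.star P) w V ↔ w ∈ P.lang∗ ∧ V = Assoc.single w := by
      intro w V
      rw [Match]
      exact starMatch_iff fun w => by simp only [ih.1, mem_lang_iff_exists_parse]
    constructor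
    · intro w V
      rw [h, Parse]
      simp only [Language.mem_one, List.nil_eq, List.append_eq_nil_iff]
      grind
    · intro Q hQ w₁ w₂ V₁ V₂
      simp only [MatchPair, Parse, h, hQ]
      have := hQ w₂
      grind
  | alt P₁ P₂ ih₁ ih₂ =>
    constructor
    · intro w V
      rw [Match, Parse]
      simp only [ih₁.1, ih₂.1, ← mem_lang_iff_exists_parse, mul_one, List.append_nil]
    · intro Q hQ w₁ w₂ V₁ V₂
      have h : (∃ W, Match (.cat P₁ Q) (w₁ ++ w₂) W) ↔ w₁ ++ w₂ ∈ P₁.lang * Q.lang := by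
        rw [Match]
        constructor
        · rintro ⟨W, a, b, U₁, U₂, hm, he, -⟩
          rw [he]
          have := ((ih₁.2 Q hQ _ _ _ _).1 hm).1.mem
          exact Language.append_mem_mul this.1 this.2
        · intro hm
          obtain ⟨a, b, U, he, hU⟩ := exists_parse hm
          obtain ⟨V, hV⟩ := (hQ b).2 hU.mem.2
          exact ⟨_, a, b, U, V, (ih₁.2 Q hQ _ _ _ _).2 ⟨hU, hV⟩, he, rfl⟩
      simp only [MatchPair, Parse, h, ih₁.2 Q hQ, ih₂.2 Q hQ]
      grind
  | cat P₁ P₂ ih₁ ih₂ =>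
    have hm₂ : ∀ w, (∃ V, Match P₂ w V) ↔ w ∈ P₂.lang := fun w => by
      simp only [ih₂.1, mem_lang_iff_exists_parse]
    constructor
    · intro w V
      rw [Match, Parse]
      simp only [ih₁.2 P₂ hm₂, ih₂.1, mul_one, List.append_nil, and_assoc]
    · intro Q hQ w₁ w₂ V₁ V₂
      have h : ∀ w, (∃ W, Match (.cat P₂ Q) w W) ↔ w ∈ (P₂.cat Q).lang := by
        intro w
        rw [Match]
        constructor
        · rintro ⟨W, a, b, U₁, U₂, hm, rfl, -⟩
          have := ((ih₂.2 Q hQ _ _ _ _).1 hm).1.mem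
          exact Language.append_mem_mul this.1 this.2
        · intro hm
          obtain ⟨a, b, U, he, hU⟩ := exists_parse hm
          obtain ⟨V, hV⟩ := (hQ b).2 hU.mem.2
          exact ⟨_, a, b, U, V, (ih₂.2 Q hQ _ _ _ _).2 ⟨hU, hV⟩, he, rfl⟩
      simp only [MatchPair, Parse, ih₁.2 _ h, ih₂.2 Q hQ]
      constructor
      · rintro ⟨a, b, U₁, U₂, W, ⟨h₁, -⟩, ⟨h₂, h₃⟩, rfl, rfl⟩
        exact ⟨⟨a, b, U₁, U₂, h₁, h₂, rfl, rfl⟩, h₃⟩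
      · rintro ⟨⟨a, b, U₁, U₂, h₁, h₂, rfl, rfl⟩, h₃⟩
        -- The association `W` is discarded by the rule, so any match of the remainder will do.
        obtain ⟨W, hW⟩ := (h _).2 (Language.append_mem_mul h₂.mem.1 h₂.mem.2)
        exact ⟨a, b, U₁, U₂, W, ⟨h₁, hW⟩, ⟨h₂, h₃⟩, rfl, rfl⟩

theorem match_iff_parse {P : Pattern α} {w : List α} {V : Assoc α} :
    Match P w V ↔ Parse P 1 w [] V :=
  (match_and_matchPair_iff P).1 w V

-- Bindings of a single node

/-- `Binds P K n w₁ w₂ u`: in the word `w₁ ++ w₂`, to be matched by `P` followed by a word of `K`,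
the pattern `P` is responsible for `w₁`, and the node `n` of `P` is associated with `u`. -/
def Binds (P : Pattern α) (K : Language α) (n : Node) (w₁ w₂ u : List α) : Prop :=
  ∃ V, Parse P K w₁ w₂ V ∧ V n = some u

theorem single_eq_some_iff {w u : List α} {n : Node} :
    Assoc.single w n = some u ↔ n = [] ∧ u = w := by
  cases n <;> simp [Assoc.single, eq_comm]

theorem binds_eps_iff {K : Language α} {n : Node} {w₁ w₂ u : List α} :
    Binds .eps K n w₁ w₂ u ↔ n = [] ∧ u = w₁ ∧ w₁ = [] ∧ w₂ ∈ K := by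
  constructor
  · rintro ⟨V, ⟨rfl, rfl, h⟩, hu⟩
    rw [single_eq_some_iff] at hu
    exact ⟨hu.1, hu.2, rfl, h⟩
  · rintro ⟨rfl, rfl, rfl, h⟩
    exact ⟨_, ⟨rfl, rfl, h⟩, rfl⟩

theorem binds_sym_iff {a : α} {K : Language α} {n : Node} {w₁ w₂ u : List α} :
    Binds (.sym a) K n w₁ w₂ u ↔ n = [] ∧ u = w₁ ∧ w₁ = [a] ∧ w₂ ∈ K := by
  constructor
  · rintro ⟨V, ⟨rfl, rfl, h⟩, hu⟩
    rw [single_eq_some_iff] at hu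
    exact ⟨hu.1, hu.2, rfl, h⟩
  · rintro ⟨rfl, rfl, rfl, h⟩
    exact ⟨_, ⟨rfl, rfl, h⟩, rfl⟩

theorem binds_star_iff {P : Pattern α} {K : Language α} {n : Node} {w₁ w₂ u : List α} :
    Binds (.star P) K n w₁ w₂ u ↔ n = [] ∧ u = w₁ ∧ w₁ ∈ P.lang∗ ∧ w₂ ∈ K ∧
      ¬ ∃ w₃ w₄, w₃ ≠ [] ∧ w₂ = w₃ ++ w₄ ∧ w₁ ++ w₃ ∈ P.lang∗ ∧ w₄ ∈ K := by
  constructor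
  · rintro ⟨V, ⟨h₁, rfl, h⟩, hu⟩
    rw [single_eq_some_iff] at hu
    exact ⟨hu.1, hu.2, h₁, h⟩
  · rintro ⟨rfl, rfl, h₁, h⟩
    exact ⟨_, ⟨h₁, rfl, h⟩, rfl⟩

theorem binds_alt_iff {P₁ P₂ : Pattern α} {K : Language α} {n : Node} {w₁ w₂ u : List α} :
    Binds (.alt P₁ P₂) K n w₁ w₂ u ↔
      (n.head? ≠ some true ∧ Binds P₁ K n.tail w₁ w₂ u) ∨
      (n.head? ≠ some false ∧ Binds P₂ K n.tail w₁ w₂ u ∧ w₁ ++ w₂ ∉ P₁.lang * K) := by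
  constructor
  · rintro ⟨V, ⟨U, h, rfl⟩ | ⟨U, h, h', rfl⟩, hu⟩
    · rcases n with _ | ⟨_ | _, n⟩
      · exact .inl ⟨by simp, U, h, hu⟩
      · exact .inl ⟨by simp, U, h, hu⟩
      · simp [Assoc.altLeft] at hu
    · rcases n with _ | ⟨_ | _, n⟩
      · exact .inr ⟨by simp, ⟨U, h, hu⟩, h'⟩
      · simp [Assoc.altRight] at hu
      · exact .inr ⟨by simp, ⟨U, h, hu⟩, h'⟩
  · rintro (⟨hn, U, h, hu⟩ | ⟨hn, ⟨U, h, hu⟩, h'⟩)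
    · refine ⟨_, .inl ⟨U, h, rfl⟩, ?_⟩
      rcases n with _ | ⟨_ | _, n⟩
      · exact hu
      · exact hu
      · simp at hn
    · refine ⟨_, .inr ⟨U, h, h', rfl⟩, ?_⟩
      rcases n with _ | ⟨_ | _, n⟩
      · exact hu
      · simp at hn
      · exact hu

/-- A parse always binds the root to the whole parsed word. Hence `Binds` at node `[]` with value
`a` or `b` expresses mere parsability of the factor that does not contain `n`, and associations
disappear from the recursion. -/
theorem binds_cat_iff {P₁ P₂ : Pattern α} {K : Language α} {n : Node} {w₁ w₂ u : List α} :
    Binds (.cat P₁ P₂) K n w₁ w₂ u ↔ ∃ a b, w₁ = a ++ b ∧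
      ((n = [] ∧ u = w₁ ∧ Binds P₁ (P₂.lang * K) [] a (b ++ w₂) a ∧ Binds P₂ K [] b w₂ b) ∨
      (n.head? = some false ∧ Binds P₁ (P₂.lang * K) n.tail a (b ++ w₂) u ∧
        Binds P₂ K [] b w₂ b) ∨
      (n.head? = some true ∧ Binds P₁ (P₂.lang * K) [] a (b ++ w₂) a ∧
        Binds P₂ K n.tail b w₂ u)) := by
  constructor
  · rintro ⟨V, ⟨a, b, V₁, V₂, h₁, h₂, rfl, rfl⟩, hu⟩
    refine ⟨a, b, rfl, ?_⟩
    rcases n with _ | ⟨_ | _, n⟩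
    · left
      simp only [Assoc.cat, h₁.nil, h₂.nil, Option.some.injEq] at hu
      exact ⟨rfl, hu.symm, ⟨V₁, h₁, h₁.nil⟩, ⟨V₂, h₂, h₂.nil⟩⟩
    · exact .inr (.inl ⟨rfl, ⟨V₁, h₁, hu⟩, ⟨V₂, h₂, h₂.nil⟩⟩)
    · exact .inr (.inr ⟨rfl, ⟨V₁, h₁, h₁.nil⟩, ⟨V₂, h₂, hu⟩⟩)
  · rintro ⟨a, b, rfl, h⟩
    rcases h with ⟨rfl, rfl, ⟨V₁, h₁, h₁'⟩, ⟨V₂, h₂, h₂'⟩⟩ | ⟨hn, ⟨V₁, h₁, h₁'⟩, ⟨V₂, h₂, h₂'⟩⟩ |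
      ⟨hn, ⟨V₁, h₁, h₁'⟩, ⟨V₂, h₂, h₂'⟩⟩
    · exact ⟨_, ⟨a, b, V₁, V₂, h₁, h₂, rfl, rfl⟩, by simp [Assoc.cat, h₁', h₂']⟩
    · refine ⟨_, ⟨a, b, V₁, V₂, h₁, h₂, rfl, rfl⟩, ?_⟩
      rcases n with _ | ⟨_ | _, n⟩
      · simp at hn
      · exact h₁'
      · simp at hn
    · refine ⟨_, ⟨a, b, V₁, V₂, h₁, h₂, rfl, rfl⟩, ?_⟩
      rcases n with _ | ⟨_ | _, n⟩
      · simp at hn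
      · simp at hn
      · exact h₂'

theorem mem_typeOf_iff {P : Pattern α} {n : Node} {C : Language α} {u : List α} :
    u ∈ typeOf n P C ↔ ∃ w ∈ C, Binds P 1 n w [] u := by
  simp only [Binds, ← match_iff_parse]
  rfl

/-- Only the short words of `K` influence a parse. -/
theorem Parse.congr {P : Pattern α} {K K' : Language α} {w₁ w₂ : List α} {V : Assoc α}
    (hK : ∀ w, w.length ≤ (w₁ ++ w₂).length → (w ∈ K ↔ w ∈ K')) (h : Parse P K w₁ w₂ V) :
    Parse P K' w₁ w₂ V := by
  induction P generalizing K K' w₁ w₂ V with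
  | eps => exact ⟨h.1, h.2.1, (hK _ (by simp)).1 h.2.2⟩
  | sym a => exact ⟨h.1, h.2.1, (hK _ (by simp)).1 h.2.2⟩
  | star P _ =>
    obtain ⟨h₁, h₂, h₃, h₄⟩ := h
    refine ⟨h₁, h₂, (hK _ (by simp)).1 h₃, ?_⟩
    rintro ⟨w₃, w₄, h₅, rfl, h₆, h₇⟩
    exact h₄ ⟨w₃, w₄, h₅, rfl, h₆, (hK _ (by simp; omega)).2 h₇⟩
  | alt P₁ P₂ ih₁ ih₂ =>
    rcases h with ⟨U, h, rfl⟩ | ⟨U, h, h', rfl⟩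
    · exact .inl ⟨U, ih₁ hK h, rfl⟩
    · refine .inr ⟨U, ih₂ hK h, ?_, rfl⟩
      rintro ⟨a, ha, b, hb, hab⟩
      refine h' ⟨a, ha, b, (hK _ ?_).2 hb, hab⟩
      rw [← hab]
      simp
  | cat P₁ P₂ ih₁ ih₂ =>
    obtain ⟨a, b, V₁, V₂, h₁, h₂, rfl, rfl⟩ := h
    refine ⟨a, b, V₁, V₂, ih₁ ?_ h₁, ih₂ ?_ h₂, rfl, rfl⟩
    · have key : ∀ K K' : Language α,
          (∀ w, w.length ≤ (a ++ b ++ w₂).length → (w ∈ K ↔ w ∈ K')) →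
          ∀ w, w.length ≤ (a ++ (b ++ w₂)).length → w ∈ P₂.lang * K → w ∈ P₂.lang * K' := by
        rintro K K' hK w hw ⟨x, hx, y, hy, rfl⟩
        refine Language.append_mem_mul hx ((hK _ ?_).1 hy)
        simp at hw ⊢
        omega
      exact fun w hw => ⟨key K K' hK w hw, key K' K (fun w hw => (hK w hw).symm) w hw⟩
    · intro w hw
      apply hK
      simp at hw ⊢
      omega

/-- This permits replacing a continuation language by a finite list of its short words in the
tables. -/
theorem Binds.congr {P : Pattern α} {K K' : Language α} {n : Node} {w₁ w₂ u : List α}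
    (hK : ∀ w, w.length ≤ (w₁ ++ w₂).length → (w ∈ K ↔ w ∈ K')) :
    Binds P K n w₁ w₂ u ↔ Binds P K' n w₁ w₂ u :=
  ⟨fun ⟨V, h, hu⟩ => ⟨V, h.congr hK, hu⟩,
    fun ⟨V, h, hu⟩ => ⟨V, h.congr fun w hw => (hK w hw).symm, hu⟩⟩

-- Finite-index congruences and their refinement

theorem append_mem_kstar {X : Language α} {m₁ m₂ : List α} (h : m₁ ++ m₂ ∈ X∗) :
    (m₁ ∈ X∗ ∧ m₂ ∈ X∗) ∨
      ∃ p c d q, m₁ = p ++ c ∧ m₂ = d ++ q ∧ p ∈ X∗ ∧ q ∈ X∗ ∧ c ++ d ∈ X := by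
  obtain ⟨L, hL, hX⟩ := Language.mem_kstar.1 h
  clear h
  induction L generalizing m₁ with
  | nil =>
    obtain ⟨rfl, rfl⟩ := List.append_eq_nil_iff.1 hL
    exact .inl ⟨Language.nil_mem_kstar _, Language.nil_mem_kstar _⟩
  | cons x L ih =>
    have hx : x ∈ X := hX x (by simp)
    have hX' : ∀ y ∈ L, y ∈ X := fun y hy => hX y (by simp [hy])
    have hcons : ∀ y, y ∈ X∗ → x ++ y ∈ X∗ := fun y hy => by
      rw [← Language.one_add_self_mul_kstar_eq_kstar]
      exact .inr (Language.append_mem_mul hx hy)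
    rw [List.flatten_cons] at hL
    rcases List.append_eq_append_iff.1 hL with ⟨e, rfl, he⟩ | ⟨e, rfl, he⟩
    · exact .inr ⟨[], m₁, e, L.flatten, rfl, he, Language.nil_mem_kstar _,
        Language.join_mem_kstar hX', hx⟩
    · rcases ih he.symm hX' with ⟨h₁, h₂⟩ | ⟨p, c, d, q, rfl, rfl, hp, hq, hcd⟩
      · exact .inl ⟨hcons _ h₁, h₂⟩
      · exact .inr ⟨x ++ p, c, d, q, by simp, rfl, hcons _ hp, hq, hcd⟩

/-- A congruence of finite index on words, given by a colouring of the words, for which the empty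
word forms a class of its own. -/
structure Coloring (α : Type u) where
  κ : Type u
  [finite : Finite κ]
  color : List α → κ
  append {u u' v v' : List α} : color u = color u' → color v = color v' →
    color (u ++ v) = color (u' ++ v')
  eq_nil {u : List α} : color u = color [] → u = []

attribute [instance] Coloring.finite

namespace Coloring

/-- The language is a union of classes. -/
def Respects (F : Coloring α) (X : Language α) : Prop :=
  ∀ ⦃u v : List α⦄, F.color u = F.color v → u ∈ X → v ∈ X

theorem respects_one (F : Coloring α) : F.Respects 1 := by
  rintro u v h rfl
  exact F.eq_nil h.symm

theorem Respects.add {F : Coloring α} {X Y : Language α} (hX : F.Respects X)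
    (hY : F.Respects Y) : F.Respects (X + Y) :=
  fun _ _ h hu => hu.imp (hX h) (hY h)

/-- The words with colours in `X`. -/
def wordsOf (F : Coloring α) (X : Set F.κ) : Language α := {w | F.color w ∈ X}

/-- The colours of the outer parts of the factorizations of `u` into three words, the middle one
being in the closure of the language with colours `X`. -/
def frames (F : Coloring α) (u : List α) (X : Set F.κ) : Set (F.κ × F.κ) :=
  {p | ∃ a m b, u = a ++ (m ++ b) ∧ m ∈ (F.wordsOf X)∗ ∧
    p = (F.color a, F.color b)}

/-- The boundary between `u` and `v` falls into one of the three parts of the factorization. Only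
the middle part is delicate: there the boundary either separates two blocks of the closure or cuts a
block `c ++ d`. In the latter case the transferred halves form a block of the same colour. -/
theorem frames_append_subset (F : Coloring α) {u u' v v' : List α}
    (hu : F.color u = F.color u') (hv : F.color v = F.color v')
    {X : Set F.κ} (hu' : F.frames u X ⊆ F.frames u' X) (hv' : F.frames v X ⊆ F.frames v' X) :
    F.frames (u ++ v) X ⊆ F.frames (u' ++ v') X := by
  rintro _ ⟨a, m, b, he, hm, rfl⟩
  rcases List.append_eq_append_iff.1 he with ⟨a₂, rfl, rfl⟩ | ⟨r, rfl, hr⟩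
  · obtain ⟨a', m', b', rfl, hm', hp⟩ := hv' ⟨a₂, m, b, rfl, hm, rfl⟩
    rw [Prod.mk.injEq] at hp
    exact ⟨u' ++ a', m', b', by simp, hm', Prod.ext (F.append hu hp.1) hp.2⟩
  · rcases List.append_eq_append_iff.1 hr with ⟨b₁, rfl, rfl⟩ | ⟨m₂, rfl, rfl⟩
    · obtain ⟨a', m', b', rfl, hm', hp⟩ := hu' ⟨a, m, b₁, rfl, hm, rfl⟩
      rw [Prod.mk.injEq] at hp
      exact ⟨a', m', b' ++ v', by simp, hm', Prod.ext hp.1 (F.append hp.2 hv)⟩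
    · rcases append_mem_kstar hm with ⟨h₁, h₂⟩ | ⟨p, c, d, q, rfl, rfl, hp, hq, hcd⟩
      · obtain ⟨a', m', e, rfl, hm', hp⟩ := hu' ⟨a, r, [], by simp, h₁, rfl⟩
        obtain ⟨f, n', b', rfl, hn', hq⟩ := hv' ⟨[], m₂, b, rfl, h₂, rfl⟩
        rw [Prod.mk.injEq] at hp hq
        -- As the empty word is alone in its class, the transferred factorizations meet exactly at
        -- the boundary.
        obtain rfl := F.eq_nil hp.2.symm
        obtain rfl := F.eq_nil hq.1.symm
        refine ⟨a', m' ++ n', b', by simp, ?_, Prod.ext hp.1 hq.2⟩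
        rw [← kstar_mul_kstar]
        exact Language.append_mem_mul hm' hn'
      · obtain ⟨a', p', c', rfl, hp', hac⟩ := hu' ⟨a, p, c, rfl, hp, rfl⟩
        obtain ⟨d', q', b', rfl, hq', hdb⟩ := hv' ⟨d, q, b, by simp, hq, rfl⟩
        rw [Prod.mk.injEq] at hac hdb
        refine ⟨a', p' ++ ((c' ++ d') ++ q'), b', by simp, ?_, Prod.ext hac.1 hdb.2⟩
        rw [← kstar_mul_kstar, ← Language.one_add_self_mul_kstar_eq_kstar]
        refine Language.append_mem_mul ?_ (.inr (Language.append_mem_mul ?_ hq'))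
        · rwa [Language.one_add_self_mul_kstar_eq_kstar]
        · change F.color (c' ++ d') ∈ X
          rwa [← F.append hac.2 hdb.1]

/-- A finer congruence, which takes factorizations into account. -/
def refine (F : Coloring α) : Coloring α where
  κ := F.κ × (Set F.κ → Set (F.κ × F.κ))
  -- All sets of colours are recorded at once, so a single refinement serves every language
  -- respected by `F`.
  color u := (F.color u, F.frames u)
  append {u u' v v'} hu hv := by
    rw [Prod.mk.injEq] at hu hv ⊢
    refine ⟨F.append hu.1 hv.1, funext fun X => Set.Subset.antisymm ?_ ?_⟩
    · exact F.frames_append_subset hu.1 hv.1 (by rw [hu.2]) (by rw [hv.2])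
    · exact F.frames_append_subset hu.1.symm hv.1.symm (by rw [hu.2]) (by rw [hv.2])
  eq_nil h := F.eq_nil (Prod.mk.injEq .. ▸ h).1

theorem color_of_refine {F : Coloring α} {u v : List α}
    (h : F.refine.color u = F.refine.color v) : F.color u = F.color v :=
  congrArg Prod.fst h

theorem exists_factorization {F : Coloring α} {X : Language α} (hX : F.Respects X)
    {a m b v : List α} (h : F.refine.color (a ++ (m ++ b)) = F.refine.color v) (hm : m ∈ X∗) :
    ∃ a' m' b', v = a' ++ (m' ++ b') ∧ m' ∈ X∗ ∧ F.color a = F.color a' ∧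
      F.color b = F.color b' := by
  -- A respected language is recovered from its colours, so its closure is among those recorded by
  -- the frames.
  have hpre : F.wordsOf (F.color '' X) = X := by
    ext w
    constructor
    · rintro ⟨x, hx, hxw⟩
      exact hX hxw hx
    · exact fun hw => ⟨w, hw, rfl⟩
  have hf : F.frames (a ++ (m ++ b)) = F.frames v := congrArg Prod.snd h
  have hmem : (F.color a, F.color b) ∈ F.frames (a ++ (m ++ b)) (F.color '' X) :=
    ⟨a, m, b, rfl, by rwa [hpre], rfl⟩
  rw [hf] at hmem
  obtain ⟨a', m', b', rfl, hm', hp⟩ := hmem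
  rw [Prod.mk.injEq] at hp
  exact ⟨a', m', b', rfl, hpre ▸ hm', hp⟩

theorem exists_split {F : Coloring α} {a b v : List α}
    (h : F.refine.color (a ++ b) = F.refine.color v) :
    ∃ a' b', v = a' ++ b' ∧ F.color a = F.color a' ∧ F.color b = F.color b' := by
  -- The closure of the empty language is {λ}, so the middle part vanishes and a two-part split
  -- remains.
  obtain ⟨a', m', b', rfl, hm, ha, hb⟩ := exists_factorization (F := F) (X := 0) (m := [])
    (fun _ _ _ hu => hu) h (Language.nil_mem_kstar _)
  rw [kstar_zero] at hm
  obtain rfl := (Language.mem_one _).1 hm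
  exact ⟨a', b', rfl, ha, hb⟩

theorem Respects.mul {F : Coloring α} {X Y : Language α} (hX : F.Respects X)
    (hY : F.Respects Y) : F.refine.Respects (X * Y) := by
  rintro _ v h ⟨a, ha, b, hb, rfl⟩
  obtain ⟨a', b', rfl, ha', hb'⟩ := exists_split h
  exact Language.append_mem_mul (hX ha' ha) (hY hb' hb)

theorem Respects.kstar {F : Coloring α} {X : Language α} (hX : F.Respects X) :
    F.refine.Respects X∗ := by
  intro u v h hu
  obtain ⟨a', m', b', rfl, hm, ha, hb⟩ :=
    exists_factorization (a := []) (m := u) (b := []) hX (by simpa using h) hu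
  obtain rfl := F.eq_nil ha.symm
  obtain rfl := F.eq_nil hb.symm
  simpa using hm

-- Iterated refinement and transfer of bindings

/-- The colouring after `k` refinements. -/
def level (F : Coloring α) (k : ℕ) : Coloring α := refine^[k] F

theorem level_succ (F : Coloring α) (k : ℕ) : F.level (k + 1) = (F.level k).refine :=
  Function.iterate_succ_apply' ..

theorem color_of_level {F : Coloring α} {j k : ℕ} (hjk : j ≤ k) {u v : List α}
    (h : (F.level k).color u = (F.level k).color v) :
    (F.level j).color u = (F.level j).color v := by
  induction k, hjk using Nat.le_induction with
  | base => exact h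
  | succ k _ ih =>
    rw [level_succ] at h
    exact ih (color_of_refine h)

theorem Respects.level {F : Coloring α} {X : Language α} {j k : ℕ}
    (h : (F.level j).Respects X) (hjk : j ≤ k) : (F.level k).Respects X :=
  fun _ _ huv => h (color_of_level hjk huv)

/-- Each product or star costs one refinement, so the size of the pattern bounds the level needed.
-/
theorem respects_lang {F : Coloring α} (hF : ∀ a, F.Respects {[a]}) (P : Pattern α) {k : ℕ}
    (hk : P.size ≤ k) : (F.level k).Respects P.lang := by
  induction P generalizing k with
  | eps => exact respects_one _
  | sym a => exact Respects.level (j := 0) (hF a) (Nat.zero_le _)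
  | alt P₁ P₂ ih₁ ih₂ =>
    simp only [Pattern.size] at hk
    exact (ih₁ (by omega)).add (ih₂ (by omega))
  | cat P₁ P₂ ih₁ ih₂ =>
    simp only [Pattern.size] at hk
    obtain ⟨k, rfl⟩ : ∃ j, k = j + 1 := ⟨k - 1, by omega⟩
    rw [level_succ]
    exact (ih₁ (by omega)).mul (ih₂ (by omega))
  | star P ih =>
    simp only [Pattern.size] at hk
    obtain ⟨k, rfl⟩ : ∃ j, k = j + 1 := ⟨k - 1, by omega⟩
    rw [level_succ]
    exact (ih (by omega)).kstar

/-- Whether and how a node is bound depends only on the colours of the words at a level that is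
high enough. -/
theorem exists_context_of_binds {F : Coloring α} (hF : ∀ a, F.Respects {[a]}) {P : Pattern α}
    {K : Language α} {k : ℕ} (hk : P.size ≤ k) (hK : (F.level k).Respects K) {n : Node}
    {w₁ w₂ u : List α} (h : Binds P K n w₁ w₂ u) :
    ∃ x v, w₁ = x ++ (u ++ v) ∧ ∀ l, k + 2 * P.size ≤ l → ∀ x' u' v' w₂',
      (F.level l).color x = (F.level l).color x' → (F.level l).color u = (F.level l).color u' →
      (F.level l).color v = (F.level l).color v' → (F.level l).color w₂ = (F.level l).color w₂' →
      Binds P K n (x' ++ (u' ++ v')) w₂' u' := by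
  -- Level budget: a concatenation raises `k` by one, for its continuation `P₂.lang * K`, and lowers
  -- `l` by one, for splitting a word between the factors. This accounts for the two levels per node
  -- in `k + 2 * P.size`.
  induction P generalizing K k n w₁ w₂ u with
  | eps =>
    obtain ⟨rfl, rfl, rfl, hw₂⟩ := binds_eps_iff.1 h
    refine ⟨[], [], rfl, fun l hl x' u' v' w₂' hx hu hv hw => ?_⟩
    obtain rfl := eq_nil _ hx.symm
    obtain rfl := eq_nil _ hu.symm
    obtain rfl := eq_nil _ hv.symm
    exact binds_eps_iff.2 ⟨rfl, rfl, rfl, hK.level (by omega) hw hw₂⟩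
  | sym a =>
    obtain ⟨rfl, rfl, rfl, hw₂⟩ := binds_sym_iff.1 h
    refine ⟨[], [], rfl, fun l hl x' u' v' w₂' hx hu hv hw => ?_⟩
    obtain rfl := eq_nil _ hx.symm
    obtain rfl := eq_nil _ hv.symm
    obtain rfl : u' = [a] := hF a (color_of_level (Nat.zero_le l) hu) rfl
    exact binds_sym_iff.2 ⟨rfl, rfl, rfl, hK.level (by omega) hw hw₂⟩
  | star P _ =>
    simp only [Pattern.size] at hk
    have hs : (F.level k).Respects P.lang∗ := respects_lang hF P.star (by simpa [Pattern.size])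
    obtain ⟨rfl, rfl, h₁, h₂, h₃⟩ := binds_star_iff.1 h
    refine ⟨[], [], by simp, fun l hl x' u' v' w₂' hx hu hv hw => ?_⟩
    simp only [Pattern.size] at hl
    obtain rfl := eq_nil _ hx.symm
    obtain rfl := eq_nil _ hv.symm
    refine binds_star_iff.2 ⟨rfl, by simp, ?_, hK.level (by omega) hw h₂, ?_⟩
    · simpa using hs.level (by omega) hu h₁
    · rintro ⟨w₃, w₄, h₄, rfl, h₅, h₆⟩
      have hw' := color_of_level (show k + 1 ≤ l by omega) hw
      rw [level_succ] at hw'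
      -- A longer match in the replaced word is carried back to the original, where it contradicts
      -- the longest-match condition.
      obtain ⟨w₃', w₄', rfl, e₃, e₄⟩ := exists_split hw'.symm
      refine h₃ ⟨w₃', w₄', ?_, rfl, ?_, hK e₄ h₆⟩
      · rintro rfl
        exact h₄ (eq_nil _ e₃)
      · refine hs (append _ ?_ e₃) h₅
        simpa using color_of_level (show k ≤ l by omega) hu.symm
  | alt P₁ P₂ ih₁ ih₂ =>
    simp only [Pattern.size] at hk
    rcases binds_alt_iff.1 h with ⟨hn, h⟩ | ⟨hn, h, h'⟩
    · obtain ⟨x, v, rfl, hxv⟩ := ih₁ (by omega) hK h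
      refine ⟨x, v, rfl, fun l hl x' u' v' w₂' hx hu hv hw => ?_⟩
      simp only [Pattern.size] at hl
      exact binds_alt_iff.2 (.inl ⟨hn, hxv l (by omega) _ _ _ _ hx hu hv hw⟩)
    · obtain ⟨x, v, rfl, hxv⟩ := ih₂ (by omega) hK h
      refine ⟨x, v, rfl, fun l hl x' u' v' w₂' hx hu hv hw => ?_⟩
      simp only [Pattern.size] at hl
      refine binds_alt_iff.2 (.inr ⟨hn, hxv l (by omega) _ _ _ _ hx hu hv hw, fun hmem => h' ?_⟩)
      have hm : (F.level (k + 1)).Respects (P₁.lang * K) := by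
        rw [level_succ]
        exact (respects_lang hF P₁ (by omega)).mul hK
      exact hm.level (show k + 1 ≤ l by omega)
        (append _ (append _ hx (append _ hu hv)) hw).symm hmem
  | cat P₁ P₂ ih₁ ih₂ =>
    simp only [Pattern.size] at hk
    have hm : (F.level (k + 1)).Respects (P₂.lang * K) := by
      rw [level_succ]
      exact (respects_lang hF P₂ (by omega)).mul hK
    obtain ⟨a, b, rfl, ⟨rfl, rfl, h₁, h₂⟩ | ⟨hn, h₁, h₂⟩ | ⟨hn, h₁, h₂⟩⟩ := binds_cat_iff.1 h
    · obtain ⟨x₁, v₁, e₁, k₁⟩ := ih₁ (by omega) hm h₁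
      obtain ⟨x₂, v₂, e₂, k₂⟩ := ih₂ (by omega) hK h₂
      -- The value bound here is all of `a`, so comparing lengths leaves no room for a context.
      obtain ⟨rfl, rfl⟩ : x₁ = [] ∧ v₁ = [] := by
        have := congrArg List.length e₁
        simp only [List.length_append] at this
        exact ⟨List.length_eq_zero_iff.1 (by omega), List.length_eq_zero_iff.1 (by omega)⟩
      obtain ⟨rfl, rfl⟩ : x₂ = [] ∧ v₂ = [] := by
        have := congrArg List.length e₂
        simp only [List.length_append] at this
        exact ⟨List.length_eq_zero_iff.1 (by omega), List.length_eq_zero_iff.1 (by omega)⟩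
      refine ⟨[], [], by simp, fun l hl x' u' v' w₂' hx hu hv hw => ?_⟩
      simp only [Pattern.size] at hl
      obtain rfl := eq_nil _ hx.symm
      obtain rfl := eq_nil _ hv.symm
      obtain ⟨l, rfl⟩ : ∃ j, l = j + 1 := ⟨l - 1, by omega⟩
      rw [level_succ] at hu hw
      obtain ⟨a', b', rfl, ea, eb⟩ := exists_split hu
      have hw := color_of_refine hw
      have h₁' := k₁ l (by omega) [] a' [] (b' ++ w₂') rfl ea rfl (append _ eb hw)
      have h₂' := k₂ l (by omega) [] b' [] w₂' rfl eb rfl hw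
      exact binds_cat_iff.2 ⟨a', b', by simp, .inl ⟨rfl, by simp, by simpa using h₁',
        by simpa using h₂'⟩⟩
    · obtain ⟨x₁, v₁, rfl, k₁⟩ := ih₁ (by omega) hm h₁
      obtain ⟨x₂, v₂, e₂, k₂⟩ := ih₂ (by omega) hK h₂
      obtain ⟨rfl, rfl⟩ : x₂ = [] ∧ v₂ = [] := by
        have := congrArg List.length e₂
        simp only [List.length_append] at this
        exact ⟨List.length_eq_zero_iff.1 (by omega), List.length_eq_zero_iff.1 (by omega)⟩
      refine ⟨x₁, v₁ ++ b, by simp, fun l hl x' u' v' w₂' hx hu hv hw => ?_⟩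
      simp only [Pattern.size] at hl
      obtain ⟨l, rfl⟩ : ∃ j, l = j + 1 := ⟨l - 1, by omega⟩
      rw [level_succ] at hx hu hv hw
      obtain ⟨v', b', rfl, ev, eb⟩ := exists_split hv
      have hx := color_of_refine hx
      have hu := color_of_refine hu
      have hw := color_of_refine hw
      have h₁' := k₁ l (by omega) x' u' v' (b' ++ w₂') hx hu ev (append _ eb hw)
      have h₂' := k₂ l (by omega) [] b' [] w₂' rfl eb rfl hw
      exact binds_cat_iff.2 ⟨_, b', by simp, .inr (.inl ⟨hn, h₁', by simpa using h₂'⟩)⟩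
    · obtain ⟨x₁, v₁, e₁, k₁⟩ := ih₁ (by omega) hm h₁
      obtain ⟨x₂, v₂, rfl, k₂⟩ := ih₂ (by omega) hK h₂
      obtain ⟨rfl, rfl⟩ : x₁ = [] ∧ v₁ = [] := by
        have := congrArg List.length e₁
        simp only [List.length_append] at this
        exact ⟨List.length_eq_zero_iff.1 (by omega), List.length_eq_zero_iff.1 (by omega)⟩
      refine ⟨a ++ x₂, v₂, by simp, fun l hl x' u' v' w₂' hx hu hv hw => ?_⟩
      simp only [Pattern.size] at hl
      obtain ⟨l, rfl⟩ : ∃ j, l = j + 1 := ⟨l - 1, by omega⟩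
      rw [level_succ] at hx hu hv hw
      obtain ⟨a', x', rfl, ea, ex⟩ := exists_split hx
      have hu := color_of_refine hu
      have hv := color_of_refine hv
      have hw := color_of_refine hw
      have h₁' := k₁ l (by omega) [] a' [] ((x' ++ (u' ++ v')) ++ w₂') rfl ea rfl
        (append _ (append _ ex (append _ hu hv)) hw)
      have h₂' := k₂ l (by omega) x' u' v' w₂' ex hu hv hw
      exact binds_cat_iff.2 ⟨a', _, by simp, .inr (.inr ⟨hn, by simpa using h₁', h₂'⟩)⟩

-- Short representatives, regularity, and the colouring of an automaton

/-- Every word has the colour of a short one. -/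
theorem exists_short (F : Coloring α) {N : ℕ} (hN : Nat.card F.κ ≤ N) (w : List α) :
    ∃ w', F.color w' = F.color w ∧ w'.length ≤ N := by
  induction h : w.length using Nat.strong_induction_on generalizing w with
  | _ k ih =>
    by_cases hk : k ≤ N
    · exact ⟨w, rfl, h.trans_le hk⟩
    · have := Fintype.ofFinite F.κ
      -- Pumping: two of the `N + 1` prefixes of length at most `N` share a colour, and the segment
      -- between them can be cut out.
      obtain ⟨i, j, hij, he⟩ := Fintype.exists_ne_map_eq_of_card_lt
        (fun i : Fin (N + 1) => F.color (w.take i))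
        (by rw [Fintype.card_fin, ← Nat.card_eq_fintype_card]; omega)
      wlog hlt : i < j generalizing i j
      · exact this j i hij.symm he.symm (lt_of_le_of_ne (not_lt.1 hlt) hij.symm)
      have hj : (j : ℕ) ≤ N := Nat.lt_succ_iff.1 j.2
      have hlt' : (i : ℕ) < j := hlt
      obtain ⟨w', hw', hl⟩ := ih _ (by simp; omega) (w.take i ++ w.drop j) rfl
      refine ⟨w', hw'.trans ?_, hl⟩
      rw [F.append he rfl, List.take_append_drop]

/-- Myhill–Nerode: the left quotient by a word depends only on its colour, so there are finitely
many quotients. -/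
theorem Respects.isRegular {F : Coloring α} {X : Language α} (hX : F.Respects X) :
    X.IsRegular := by
  apply Language.IsRegular.of_finite_range_leftQuotient
  have hsub : Set.range X.leftQuotient ⊆
      Set.range fun c : F.κ => ({v | ∃ u, F.color u = c ∧ u ++ v ∈ X} : Language α) := by
    rintro _ ⟨u, rfl⟩
    refine ⟨F.color u, ?_⟩
    ext v
    constructor
    · rintro ⟨u', hu, h⟩
      exact hX (F.append hu rfl) h
    · exact fun h => ⟨u, rfl, h⟩
  exact (Set.finite_range _).subset hsub

/-- The words of length at most one are distinguished from each other and from all other words. -/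
def initial : List α → Option (Option α)
  | [] => none
  | [a] => some (some a)
  | _ => some none

theorem initial_append {u u' v v' : List α} (hu : initial u = initial u')
    (hv : initial v = initial v') : initial (u ++ v) = initial (u' ++ v') := by
  rcases u with _ | ⟨a, _ | ⟨b, u⟩⟩ <;> rcases u' with _ | ⟨a', _ | ⟨b', u'⟩⟩ <;>
    simp only [initial, reduceCtorEq, Option.some.injEq] at hu <;>
    rcases v with _ | ⟨c, _ | ⟨d, v⟩⟩ <;> rcases v' with _ | ⟨c', _ | ⟨d', v'⟩⟩ <;>
    simp only [initial, reduceCtorEq, Option.some.injEq] at hv <;>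
    simp [initial, hu, hv]

/-- The colouring given by the transformations of the states of an automaton. -/
def ofDFA {σ : Type} [Finite σ] [Finite α] (M : DFA α σ) : Coloring α where
  κ := Option (Option α) × (σ → σ)
  color u := (initial u, fun s => M.evalFrom s u)
  append {u u' v v'} hu hv := by
    simp only [Prod.mk.injEq, funext_iff, DFA.evalFrom_of_append] at hu hv ⊢
    exact ⟨initial_append hu.1 hv.1, fun s => by rw [hu.2, hv.2]⟩
  eq_nil {u} h := by
    have h₁ := congrArg Prod.fst h
    rcases u with _ | ⟨_, _ | _⟩ <;> simp_all [initial]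

theorem ofDFA_respects_singleton {σ : Type} [Finite σ] [Finite α] (M : DFA α σ) (a : α) :
    (ofDFA M).Respects {[a]} := by
  rintro u v h rfl
  have h₁ : initial [a] = initial v := congrArg Prod.fst h
  rcases v with _ | ⟨_, _ | _⟩ <;> simp_all [initial]
  rfl

theorem ofDFA_respects_accepts {σ : Type} [Finite σ] [Finite α] (M : DFA α σ) :
    (ofDFA M).Respects M.accepts := by
  intro u v h hu
  have h₁ : M.evalFrom M.start u = M.evalFrom M.start v := congrFun (congrArg Prod.snd h) _
  change M.evalFrom M.start u ∈ M.accept at hu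
  change M.evalFrom M.start v ∈ M.accept
  rwa [← h₁]

end Coloring

-- Counting colours, and regularity of the type

/-- A bound for the number of colours after a refinement. -/
def refineCard (n : ℕ) : ℕ := n * (2 ^ (n * n)) ^ 2 ^ n

theorem Coloring.card_level (F : Coloring α) (k : ℕ) :
    Nat.card (F.level k).κ = refineCard^[k] (Nat.card F.κ) := by
  induction k with
  | zero => rfl
  | succ k ih =>
    rw [level_succ, Function.iterate_succ_apply', ← ih]
    have h : ∀ κ : Type u, [Finite κ] →
        Nat.card (κ × (Set κ → Set (κ × κ))) = refineCard (Nat.card κ) := by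
      intro κ _
      have := Fintype.ofFinite κ
      classical
      simp [refineCard]
    exact h _

section typeOf

variable {F : Coloring α} {P : Pattern α} {C : Language α}

/-- Membership in the type of a node depends only on the colours, and the context of a word in the
type can be replaced by one with the same colours. -/
theorem exists_context_of_mem_typeOf (hF : ∀ a, F.Respects {[a]}) (hC : F.Respects C) {n : Node}
    {u : List α} (h : u ∈ typeOf n P C) :
    ∃ x v, ∀ x' u' v', (F.level (3 * P.size)).color x = (F.level (3 * P.size)).color x' →
      (F.level (3 * P.size)).color u = (F.level (3 * P.size)).color u' →
      (F.level (3 * P.size)).color v = (F.level (3 * P.size)).color v' →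
      x' ++ (u' ++ v') ∈ C ∧ Binds P 1 n (x' ++ (u' ++ v')) [] u' := by
  obtain ⟨w, hw, hb⟩ := mem_typeOf_iff.1 h
  obtain ⟨x, v, rfl, hxv⟩ := Coloring.exists_context_of_binds hF le_rfl
    (Coloring.respects_one _) hb
  refine ⟨x, v, fun x' u' v' hx hu hv => ⟨?_, hxv _ (by omega) x' u' v' [] hx hu hv rfl⟩⟩
  exact (show (F.level 0).Respects C from hC).level (Nat.zero_le _)
    (Coloring.append _ hx (Coloring.append _ hu hv)) hw

theorem respects_typeOf (hF : ∀ a, F.Respects {[a]}) (hC : F.Respects C) (n : Node) :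
    (F.level (3 * P.size)).Respects (typeOf n P C) := by
  intro u u' huu' h
  obtain ⟨x, v, hxv⟩ := exists_context_of_mem_typeOf hF hC h
  exact mem_typeOf_iff.2 ⟨_, hxv x u' v rfl huu' rfl⟩

/-- Both sides of the context of `u` are replaced by short words of the same colours, which bounds
the search for a witness. -/
theorem exists_short_of_mem_typeOf (hF : ∀ a, F.Respects {[a]}) (hC : F.Respects C) {n : Node}
    {N : ℕ} (hN : Nat.card (F.level (3 * P.size)).κ ≤ N) {u : List α} (h : u ∈ typeOf n P C) :
    ∃ w ∈ C, w.length ≤ u.length + 2 * N ∧ Binds P 1 n w [] u := by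
  obtain ⟨x, v, hxv⟩ := exists_context_of_mem_typeOf hF hC h
  obtain ⟨x', hx, hlx⟩ := Coloring.exists_short _ hN x
  obtain ⟨v', hv, hlv⟩ := Coloring.exists_short _ hN v
  obtain ⟨h₁, h₂⟩ := hxv x' u v' hx.symm rfl hv.symm
  exact ⟨_, h₁, by simp; omega, h₂⟩

end typeOf

theorem isRegular_typeOf [Finite α] (P : Pattern α) (n : Node) {C : Language α}
    (hC : C.IsRegular) : (typeOf n P C).IsRegular := by
  obtain ⟨σ, _, M, rfl⟩ := hC
  exact (respects_typeOf (Coloring.ofDFA_respects_singleton M)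
    (Coloring.ofDFA_respects_accepts M) n).isRegular

-- Exhaustive tables for words of bounded length

/-- The words of length at most `n` over the listed letters. -/
def shortWords (letters : List α) : ℕ → List (List α)
  | 0 => [[]]
  | n + 1 => [] :: (shortWords letters n).flatMap fun w => letters.map fun a => a :: w

theorem mem_shortWords {letters : List α} (h : ∀ a, a ∈ letters) {n : ℕ} {w : List α} :
    w ∈ shortWords letters n ↔ w.length ≤ n := by
  induction n generalizing w with
  | zero => simp [shortWords]
  | succ n ih =>
    cases w with
    | nil => simp [shortWords]
    | cons a w => simp [shortWords, ih, h]

/-- The language of the listed words. -/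
def ofList (K : List (List α)) : Language α := {w | w ∈ K}

theorem mem_ofList {K : List (List α)} {w : List α} : w ∈ ofList K ↔ w ∈ K := Iff.rfl

/-- The word `w`, from the list `U`, belongs to the language of a pattern with the root label `l`,
where `L₁` and `L₂` list the words from `U` in the languages of the two subpatterns. -/
def IsWord (U : List (List α)) (l : Label α) (L₁ L₂ : List (List α)) (w : List α) : Prop :=
  -- The equation `[l] = w.map .sym` says that `l` is a letter and `w` that letter, without a
  -- quantifier over letters.
  (l = .eps ∧ w = []) ∨ [l] = w.map .sym ∨ (l = .alt ∧ (w ∈ L₁ ∨ w ∈ L₂)) ∨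
    (l = .cat ∧ ∃ a ∈ L₁, ∃ b ∈ L₂, a ++ b = w) ∨
    -- Membership in the closure is membership in the least closed set, with the quantifier bounded
    -- by the sublists of `U`.
    (l = .star ∧ ∀ Z ∈ U.sublists', [] ∈ Z →
      (∀ a ∈ Z, ∀ b ∈ L₁, a ++ b ∈ U → a ++ b ∈ Z) → w ∈ Z)

open scoped Classical in
/-- The list of the words in `U` with `IsWord`. -/
noncomputable def wordList (U : List (List α)) (l : Label α) (L₁ L₂ : List (List α)) :
    List (List α) :=
  U.filter fun w => IsWord U l L₁ L₂ w

/-- Arguments of `Binds`. -/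
abbrev Binding (α : Type u) := List (List α) × Node × List α × List α × List α

open scoped Classical in
/-- The words in `U` that belong to the product of two finite languages. -/
noncomputable def mulList (U L K : List (List α)) : List (List α) :=
  U.filter fun w => ∃ a ∈ L, ∃ b ∈ K, a ++ b = w

/-- The binding holds for a pattern with the root label `l`, where `L`, `L₁` and `L₂` list the words
in the languages of the pattern and its two subpatterns, and `R₁` and `R₂` list the bindings for the
subpatterns. -/
def IsBinding (U : List (List α)) (l : Label α) (L L₁ L₂ : List (List α))
    (R₁ R₂ : List (Binding α)) (K : List (List α)) (n : Node) (w₁ w₂ u : List α) : Prop :=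
  (l = .eps ∧ n = [] ∧ u = w₁ ∧ w₁ = [] ∧ w₂ ∈ K) ∨
  ([l] = w₁.map .sym ∧ n = [] ∧ u = w₁ ∧ w₂ ∈ K) ∨
  (l = .star ∧ n = [] ∧ u = w₁ ∧ w₁ ∈ L ∧ w₂ ∈ K ∧
    ¬ ∃ w₃ ∈ U, ∃ w₄ ∈ U, w₃ ≠ [] ∧ w₂ = w₃ ++ w₄ ∧ w₁ ++ w₃ ∈ L ∧ w₄ ∈ K) ∨
  (l = .alt ∧ ((n.head? ≠ some true ∧ (K, n.tail, w₁, w₂, u) ∈ R₁) ∨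
    (n.head? ≠ some false ∧ (K, n.tail, w₁, w₂, u) ∈ R₂ ∧ w₁ ++ w₂ ∉ mulList U L₁ K))) ∨
  (l = .cat ∧ ∃ a ∈ U, ∃ b ∈ U, w₁ = a ++ b ∧
    ((n = [] ∧ u = w₁ ∧ (mulList U L₂ K, [], a, b ++ w₂, a) ∈ R₁ ∧ (K, [], b, w₂, b) ∈ R₂) ∨
    (n.head? = some false ∧ (mulList U L₂ K, n.tail, a, b ++ w₂, u) ∈ R₁ ∧
      (K, [], b, w₂, b) ∈ R₂) ∨
    (n.head? = some true ∧ (mulList U L₂ K, [], a, b ++ w₂, a) ∈ R₁ ∧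
      (K, n.tail, b, w₂, u) ∈ R₂)))

/-- The bindings built from the words in `U` and the sublists of `n`. -/
def allBindings (U : List (List α)) (n : Node) : List (Binding α) :=
  -- Sublists form finite ranges closed under the recursive calls: `mulList` returns a sublist of
  -- `U`, and tails of sublists of `n` are again sublists of `n`.
  U.sublists'.flatMap fun K => n.sublists'.flatMap fun m => U.flatMap fun w₁ =>
    U.flatMap fun w₂ => U.map fun u => (K, m, w₁, w₂, u)

theorem mem_allBindings {U : List (List α)} {n : Node} {K : List (List α)} {m : Node}
    {w₁ w₂ u : List α} : (K, m, w₁, w₂, u) ∈ allBindings U n ↔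
      K.Sublist U ∧ m.Sublist n ∧ w₁ ∈ U ∧ w₂ ∈ U ∧ u ∈ U := by
  simp [allBindings]

/-- What is computed for a pattern: the words and the bindings. -/
abbrev Table (α : Type u) := List (List α) × List (Binding α)

open scoped Classical in
/-- The table of a pattern with the root label `l`, from the tables of the subpatterns. -/
noncomputable def table (U : List (List α)) (n : Node) (l : Label α) (v₁ v₂ : Table α) : Table α :=
  (wordList U l v₁.1 v₂.1,
    (allBindings U n).filter fun b => IsBinding U l (wordList U l v₁.1 v₂.1) v₁.1 v₂.1 v₁.2 v₂.2
      b.1 b.2.1 b.2.2.1 b.2.2.2.1 b.2.2.2.2)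

open scoped Classical in
/-- One step of the evaluation of a pattern in prefix notation with a stack. -/
noncomputable def evalStep (U : List (List α)) (n : Node) (l : Label α) (st : List (Table α)) :
    List (Table α) :=
  -- Two operands are read whatever the arity; the disjuncts for a leaf ignore both, those for a
  -- star ignore the second.
  table U n l st.headI st.tail.headI ::
    if l = .star then st.tail else if l = .alt ∨ l = .cat then st.tail.tail else st

-- Correctness of the tables

/-- `v` is the table of `P`, for the words of length at most `B` and the suffixes of `n`. -/
structure IsTable (B : ℕ) (U : List (List α)) (n : Node) (P : Pattern α) (v : Table α) : Prop where
  mem_fst (w : List α) : w ∈ v.1 ↔ w.length ≤ B ∧ w ∈ P.lang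
  mem_snd {K : List (List α)} {m : Node} {w₁ w₂ u : List α} : K.Sublist U → m.Sublist n →
    (w₁ ++ w₂).length ≤ B → u.length ≤ B → ((K, m, w₁, w₂, u) ∈ v.2 ↔ Binds P (ofList K) m w₁ w₂ u)

variable {B : ℕ} {U : List (List α)} {n : Node}

theorem mem_iff_mem_kstar_of_list (hU : ∀ w, w ∈ U ↔ w.length ≤ B) {X : Language α} {L : List (List α)}
    (hL : ∀ w, w ∈ L ↔ w.length ≤ B ∧ w ∈ X) {w : List α} (hw : w ∈ U) :
    (∀ Z ∈ U.sublists', [] ∈ Z → (∀ a ∈ Z, ∀ b ∈ L, a ++ b ∈ U → a ++ b ∈ Z) → w ∈ Z) ↔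
      w ∈ X∗ := by
  classical
  constructor
  · intro h
    -- The short words of the closure form a closed set themselves.
    have := h (U.filter (· ∈ X∗)) (by simp) (by simp [hU, Language.nil_mem_kstar]) ?_
    · simpa [hw] using this
    · intro a ha b hb hab
      simp only [List.mem_filter, decide_eq_true_eq] at ha ⊢
      refine ⟨hab, ?_⟩
      rw [← Language.one_add_kstar_mul_self_eq_kstar]
      exact .inr (Language.append_mem_mul ha.2 ((hL b).1 hb).2)
  · intro h Z _ hnil hZ
    obtain ⟨M, rfl, hM⟩ := Language.mem_kstar.1 h
    clear h
    induction M using List.reverseRecOn with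
    | nil => exact hnil
    | append_singleton M x ih =>
      rw [hU] at hw
      simp only [List.flatten_append, List.flatten_singleton, List.length_append] at hw ⊢
      refine hZ _ (ih (fun y hy => hM y (by simp [hy])) ((hU _).2 (by omega))) x
        ((hL x).2 ⟨by omega, hM x (by simp)⟩) ((hU _).2 ?_)
      simpa using hw

theorem mem_mulList (hU : ∀ w, w ∈ U ↔ w.length ≤ B) {X : Language α} {L K : List (List α)}
    (hL : ∀ w, w ∈ L ↔ w.length ≤ B ∧ w ∈ X) {w : List α} (hw : w.length ≤ B) :
    w ∈ mulList U L K ↔ w ∈ X * ofList K := by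
  simp only [mulList, List.mem_filter, hU, decide_eq_true_eq, Language.mem_mul, mem_ofList, hL]
  constructor
  · rintro ⟨-, a, ⟨-, ha⟩, b, hb, h⟩
    exact ⟨a, ha, b, hb, h⟩
  · rintro ⟨a, ha, b, hb, rfl⟩
    simp only [List.length_append] at hw
    exact ⟨by simpa using hw, a, ⟨by omega, ha⟩, b, hb, rfl⟩

theorem mulList_sublist (L K : List (List α)) : (mulList U L K).Sublist U :=
  List.filter_sublist

/-- Truncating the continuation to words of length at most `B` is harmless when the parsed word is
no longer than `B`. -/
theorem binds_mulList_iff (hU : ∀ w, w ∈ U ↔ w.length ≤ B) {P Q : Pattern α}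
    {L K : List (List α)} (hL : ∀ w, w ∈ L ↔ w.length ≤ B ∧ w ∈ Q.lang) {m : Node}
    {w₁ w₂ u : List α} (hw : (w₁ ++ w₂).length ≤ B) :
    Binds P (ofList (mulList U L K)) m w₁ w₂ u ↔ Binds P (Q.lang * ofList K) m w₁ w₂ u :=
  Binds.congr fun _ h => mem_mulList hU hL (h.trans hw)

theorem isTable_of (hU : ∀ w, w ∈ U ↔ w.length ≤ B) {P : Pattern α} {l : Label α}
    {v₁ v₂ : Table α}
    (h₁ : ∀ w, w.length ≤ B → (IsWord U l v₁.1 v₂.1 w ↔ w ∈ P.lang))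
    (h₂ : ∀ L, (∀ w, w ∈ L ↔ w.length ≤ B ∧ w ∈ P.lang) → ∀ (K : List (List α)) (m : Node)
      (w₁ w₂ u : List α), K.Sublist U → m.Sublist n → (w₁ ++ w₂).length ≤ B → u.length ≤ B →
      (IsBinding U l L v₁.1 v₂.1 v₁.2 v₂.2 K m w₁ w₂ u ↔ Binds P (ofList K) m w₁ w₂ u)) :
    IsTable B U n P (table U n l v₁ v₂) := by
  have h₃ : ∀ w, w ∈ wordList U l v₁.1 v₂.1 ↔ w.length ≤ B ∧ w ∈ P.lang := by
    intro w
    simp only [wordList, List.mem_filter, hU, decide_eq_true_eq]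
    exact and_congr_right (h₁ w)
  refine ⟨h₃, fun {K m w₁ w₂ u} hK hm hw hu => ?_⟩
  simp only [table, List.mem_filter, decide_eq_true_eq, mem_allBindings,
    h₂ _ h₃ K m w₁ w₂ u hK hm hw hu]
  simp only [List.length_append] at hw
  exact and_iff_right ⟨hK, hm, (hU _).2 (by omega), (hU _).2 (by omega), (hU _).2 hu⟩

theorem singleton_eq_map_sym_iff {a : α} {w : List α} :
    [Label.sym a] = w.map .sym ↔ w = [a] := by
  rcases w with _ | ⟨b, _ | _⟩
  · simp
  · simpa using eq_comm
  · simp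

theorem singleton_ne_map_sym {l : Label α} (hl : ∀ a, l ≠ .sym a) (w : List α) :
    [l] = w.map .sym ↔ False := by
  rcases w with _ | ⟨b, _ | _⟩ <;> simp [hl]

theorem isTable_eps (hU : ∀ w, w ∈ U ↔ w.length ≤ B) (v₁ v₂ : Table α) :
    IsTable B U n .eps (table U n .eps v₁ v₂) := by
  refine isTable_of hU (fun w _ => ?_) fun L _ K m w₁ w₂ u _ _ _ _ => ?_
  · simp [IsWord, singleton_ne_map_sym, Pattern.lang, Language.mem_one]
  · simp [IsBinding, singleton_ne_map_sym, binds_eps_iff, mem_ofList]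

theorem isTable_sym (hU : ∀ w, w ∈ U ↔ w.length ≤ B) (a : α) (v₁ v₂ : Table α) :
    IsTable B U n (.sym a) (table U n (.sym a) v₁ v₂) := by
  refine isTable_of hU (fun w _ => ?_) fun L _ K m w₁ w₂ u _ _ _ _ => ?_
  · simp only [IsWord, singleton_eq_map_sym_iff, reduceCtorEq, false_and, or_false, false_or]
    rfl
  · simp only [IsBinding, singleton_eq_map_sym_iff, binds_sym_iff, mem_ofList, reduceCtorEq,
      false_and, or_false, false_or]
    tauto

theorem isTable_star (hU : ∀ w, w ∈ U ↔ w.length ≤ B) {P : Pattern α} {v₁ : Table α}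
    (h : IsTable B U n P v₁) (v₂ : Table α) :
    IsTable B U n (.star P) (table U n .star v₁ v₂) := by
  refine isTable_of hU (fun w hw => ?_) fun L hL K m w₁ w₂ u _ _ hw _ => ?_
  · simp only [IsWord, reduceCtorEq, false_and, false_or, true_and,
      mem_iff_mem_kstar_of_list hU h.mem_fst ((hU w).2 hw), singleton_ne_map_sym (l := Label.star) (by simp)]
    rfl
  · simp only [IsBinding, reduceCtorEq, false_and, or_false, false_or, true_and,
      singleton_ne_map_sym (l := Label.star) (by simp), binds_star_iff, mem_ofList, hL,
      Pattern.lang, hU]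
    simp only [List.length_append] at hw
    refine and_congr_right fun _ => and_congr_right fun _ => and_congr ?_
      (and_congr_right fun _ => not_congr ?_)
    · exact and_iff_right (by omega)
    · constructor
      · rintro ⟨w₃, -, w₄, -, h₁, h₂, ⟨-, h₃⟩, h₄⟩
        exact ⟨w₃, w₄, h₁, h₂, h₃, h₄⟩
      · rintro ⟨w₃, w₄, h₁, rfl, h₃, h₄⟩
        simp only [List.length_append] at hw ⊢
        exact ⟨w₃, by omega, w₄, by omega, h₁, rfl, ⟨by omega, h₃⟩, h₄⟩

theorem isTable_alt (hU : ∀ w, w ∈ U ↔ w.length ≤ B) {P₁ P₂ : Pattern α} {v₁ v₂ : Table α}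
    (h₁ : IsTable B U n P₁ v₁) (h₂ : IsTable B U n P₂ v₂) :
    IsTable B U n (.alt P₁ P₂) (table U n .alt v₁ v₂) := by
  refine isTable_of hU (fun w hw => ?_) fun L hL K m w₁ w₂ u hK hm hw hu => ?_
  · simp only [IsWord, reduceCtorEq, false_and, or_false, false_or, true_and,
      singleton_ne_map_sym (l := Label.alt) (by simp), h₁.mem_fst, h₂.mem_fst, hw]
    rfl
  · have hm' := (List.tail_sublist m).trans hm
    simp only [IsBinding, reduceCtorEq, false_and, or_false, false_or, true_and,
      singleton_ne_map_sym (l := Label.alt) (by simp), binds_alt_iff,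
      h₁.mem_snd hK hm' hw hu, h₂.mem_snd hK hm' hw hu, mem_mulList hU h₁.mem_fst hw]

theorem isTable_cat (hU : ∀ w, w ∈ U ↔ w.length ≤ B) {P₁ P₂ : Pattern α} {v₁ v₂ : Table α}
    (h₁ : IsTable B U n P₁ v₁) (h₂ : IsTable B U n P₂ v₂) :
    IsTable B U n (.cat P₁ P₂) (table U n .cat v₁ v₂) := by
  refine isTable_of hU (fun w hw => ?_) fun L hL K m w₁ w₂ u hK hm hw hu => ?_
  · simp only [IsWord, reduceCtorEq, false_and, or_false, false_or, true_and,
      singleton_ne_map_sym (l := Label.cat) (by simp), h₁.mem_fst, h₂.mem_fst]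
    constructor
    · rintro ⟨a, ⟨-, ha⟩, b, ⟨-, hb⟩, rfl⟩
      exact Language.append_mem_mul ha hb
    · rintro ⟨a, ha, b, hb, rfl⟩
      simp only [List.length_append] at hw
      exact ⟨a, ⟨by omega, ha⟩, b, ⟨by omega, hb⟩, rfl⟩
  · have hm' := (List.tail_sublist m).trans hm
    simp only [IsBinding, reduceCtorEq, false_and, false_or, true_and,
      singleton_ne_map_sym (l := Label.cat) (by simp), binds_cat_iff]
    have key : ∀ a b, w₁ = a ++ b → ∀ (m : Node) (u : List α), m.Sublist n → u.length ≤ B →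
        ((mulList U v₂.1 K, m, a, b ++ w₂, u) ∈ v₁.2 ↔
          Binds P₁ (P₂.lang * ofList K) m a (b ++ w₂) u) ∧
        ((K, m, b, w₂, u) ∈ v₂.2 ↔ Binds P₂ (ofList K) m b w₂ u) := by
      rintro a b rfl m u hm hu
      rw [List.append_assoc] at hw
      rw [h₁.mem_snd (mulList_sublist _ _) hm hw hu, binds_mulList_iff hU h₂.mem_fst hw]
      refine ⟨Iff.rfl, h₂.mem_snd hK hm ?_ hu⟩
      simp only [List.length_append] at hw ⊢
      omega
    constructor
    · rintro ⟨a, ha, b, hb, he, h⟩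
      rw [hU] at ha hb
      rw [(key a b he _ _ (List.nil_sublist _) ha).1, (key a b he _ _ (List.nil_sublist _) hb).2,
        (key a b he _ _ hm' hu).1, (key a b he _ _ hm' hu).2] at h
      exact ⟨a, b, he, h⟩
    · rintro ⟨a, b, he, h⟩
      have hab : a.length ≤ B ∧ b.length ≤ B := by
        rw [he] at hw
        simp only [List.length_append] at hw
        omega
      refine ⟨a, (hU a).2 hab.1, b, (hU b).2 hab.2, he, ?_⟩
      rwa [(key a b he _ _ (List.nil_sublist _) hab.1).1,
        (key a b he _ _ (List.nil_sublist _) hab.2).2,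
        (key a b he _ _ hm' hu).1, (key a b he _ _ hm' hu).2]

/-- Folding from the right reads the prefix notation backwards, so when an operator is met the
tables of its operands lie on the stack, the first operand on top. -/
theorem foldr_evalStep (hU : ∀ w, w ∈ U ↔ w.length ≤ B) (P : Pattern α) (st : List (Table α)) :
    ∃ v, P.code.foldr (evalStep U n) st = v :: st ∧ IsTable B U n P v := by
  induction P generalizing st with
  | eps => exact ⟨table U n .eps _ _, by simp [Pattern.code, evalStep]; rfl, isTable_eps hU _ _⟩
  | sym a =>
    exact ⟨table U n (.sym a) _ _, by simp [Pattern.code, evalStep]; rfl, isTable_sym hU a _ _⟩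
  | star P ih =>
    obtain ⟨v, hv, h⟩ := ih st
    exact ⟨table U n .star v _, by simp [Pattern.code, evalStep, hv]; rfl, isTable_star hU h _⟩
  | alt P₁ P₂ ih₁ ih₂ =>
    obtain ⟨v₂, hv₂, h₂⟩ := ih₂ st
    obtain ⟨v₁, hv₁, h₁⟩ := ih₁ (v₂ :: st)
    exact ⟨_, by simp [Pattern.code, evalStep, hv₂, hv₁], isTable_alt hU h₁ h₂⟩
  | cat P₁ P₂ ih₁ ih₂ =>
    obtain ⟨v₂, hv₂, h₂⟩ := ih₂ st
    obtain ⟨v₁, hv₁, h₁⟩ := ih₁ (v₂ :: st)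
    exact ⟨_, by simp [Pattern.code, evalStep, hv₂, hv₁], isTable_cat hU h₁ h₂⟩

-- Runs of described automata

namespace FinAut

open scoped Classical in
/-- The states reached by reading `w`. -/
noncomputable def run (A : FinAut α) (w : List α) : List ℕ :=
  w.foldl (fun S a => (A.trans.filter fun t => t.2.1 = a ∧ t.1 ∈ S).map fun t => t.2.2) A.init

theorem mem_run {A : FinAut α} {w : List α} {q : ℕ} : q ∈ A.run w ↔ q ∈ A.toNFA.eval w := by
  induction w using List.reverseRecOn generalizing q with
  | nil => rfl
  | append_singleton w a ih =>
    rw [NFA.eval_append_singleton, NFA.mem_stepSet]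
    simp only [← ih]
    simp only [run, List.foldl_append, List.foldl_cons, List.foldl_nil, List.mem_map,
      List.mem_filter, decide_eq_true_eq, toNFA, Set.mem_ofPred_eq]
    constructor
    · rintro ⟨⟨p, b, r⟩, ⟨ht, rfl, hp⟩, rfl⟩
      exact ⟨p, hp, ht⟩
    · rintro ⟨p, hp, ht⟩
      exact ⟨_, ⟨ht, rfl, hp⟩, rfl⟩

theorem mem_language {A : FinAut α} {w : List α} : w ∈ A.language ↔ ∃ q ∈ A.final, q ∈ A.run w := by
  simp only [mem_run]
  exact NFA.mem_accepts

/-- The states that can occur in a run. -/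
def states (A : FinAut α) : List ℕ := A.init ++ A.trans.map fun t => t.2.2

/-- The automaton with the positions in the list of states as its states. -/
def finNFA (A : FinAut α) : NFA α (Fin A.states.length) where
  step i a := {j | (A.states[i], a, A.states[j]) ∈ A.trans}
  start := {i | A.states[i] ∈ A.init}
  accept := {i | A.states[i] ∈ A.final}

theorem mem_eval_iff {A : FinAut α} {w : List α} {q : ℕ} :
    q ∈ A.toNFA.eval w ↔ ∃ i, A.states[i] = q ∧ i ∈ A.finNFA.eval w := by
  induction w using List.reverseRecOn generalizing q with
  | nil =>
    constructor
    · intro h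
      obtain ⟨i, hi, rfl⟩ := List.mem_iff_getElem.1 (List.mem_append_left
        (A.trans.map fun t => t.2.2) (show q ∈ A.init from h))
      exact ⟨⟨i, hi⟩, rfl, h⟩
    · rintro ⟨i, rfl, h⟩
      exact h
  | append_singleton w a ih =>
    simp only [NFA.eval_append_singleton, NFA.mem_stepSet]
    constructor
    · rintro ⟨p, hp, ht⟩
      obtain ⟨i, rfl, hi⟩ := ih.1 hp
      obtain ⟨j, hj, rfl⟩ := List.mem_iff_getElem.1 (List.mem_append_right
        A.init (List.mem_map_of_mem (f := fun t => t.2.2) ht))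
      exact ⟨⟨j, hj⟩, rfl, i, hi, ht⟩
    · rintro ⟨j, rfl, i, hi, hj⟩
      exact ⟨_, ih.2 ⟨i, rfl, hi⟩, hj⟩

/-- Only initial states and targets of transitions can be reached. Restricting to them gives a
finite state set of known size, as the subset construction and the count of colours require. -/
theorem finNFA_accepts (A : FinAut α) : A.finNFA.accepts = A.language := by
  ext w
  rw [NFA.mem_accepts, language, NFA.mem_accepts]
  constructor
  · rintro ⟨i, hi, h⟩
    exact ⟨_, hi, mem_eval_iff.2 ⟨i, rfl, h⟩⟩
  · rintro ⟨q, hq, h⟩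
    obtain ⟨i, rfl, hi⟩ := mem_eval_iff.1 h
    exact ⟨i, hq, hi⟩

end FinAut

-- Deciding membership of short words in the type

/-- A bound for the number of colours that are needed for a type; `c` is the number of letters,
`q` the number of states and `k` the size of the pattern. -/
def numColors (c q k : ℕ) : ℕ := refineCard^[3 * k] ((c + 2) * (2 ^ q) ^ 2 ^ q)

theorem length_code (P : Pattern α) : P.code.length = P.size := by
  induction P <;> simp_all [Pattern.code, Pattern.size]

theorem exists_coloring [Finite α] (A : FinAut α) : ∃ F : Coloring α, (∀ a, F.Respects {[a]}) ∧
    F.Respects A.language ∧ ∀ k,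
      Nat.card (F.level (3 * k)).κ = numColors (Nat.card α) A.states.length k := by
  refine ⟨Coloring.ofDFA A.finNFA.toDFA, Coloring.ofDFA_respects_singleton _, ?_, fun k => ?_⟩
  · rw [← FinAut.finNFA_accepts, ← NFA.toDFA_correct]
    exact Coloring.ofDFA_respects_accepts _
  · rw [Coloring.card_level, numColors]
    congr 1
    have := Fintype.ofFinite α
    -- The initial colours are the `c + 2` values of `initial` paired with self-maps of the state
    -- sets of the subset automaton.
    change Nat.card (Option (Option α) × (Set (Fin A.states.length) → Set (Fin A.states.length))) = _
    classical
    simp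

section Decision

variable (letters : List α)

/-- The number of colours, as a function of the input. -/
def inputColors (code : List (Label α)) (A : FinAut α) : ℕ :=
  numColors (letters.length) A.states.length code.length

open scoped Classical in
/-- The list of the words in the type of a node, up to a certain length. -/
noncomputable def typeWords (code : List (Label α)) (n : Node) (A : FinAut α) : List (List α) :=
  -- With N colours, words up to length 2N + 1 must be decided, and a witness adds at most 2N
  -- letters of context.
  let U := shortWords letters (4 * inputColors letters code A + 1)
  let R := (code.foldr (evalStep U n) []).headI.2
  U.filter fun u => ∃ w ∈ U, (∃ q ∈ A.final, q ∈ A.run w) ∧ ([[]], n, w, [], u) ∈ R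

variable {letters}

theorem mem_typeWords [Finite α] (hl : ∀ a, a ∈ letters) (hc : letters.length = Nat.card α) {P : Pattern α} {n : Node}
    {A : FinAut α} {u : List α} (hu : u.length ≤ 2 * inputColors letters P.code A + 1) :
    u ∈ typeWords letters P.code n A ↔ u ∈ typeOf n P A.language := by
  set N := inputColors letters P.code A with hN
  have hU := fun w => mem_shortWords hl (n := 4 * N + 1) (w := w)
  obtain ⟨v, hv, hT⟩ := foldr_evalStep (n := n) hU P []
  have h1 : ofList [[]] = (1 : Language α) := by
    ext w
    simp [mem_ofList, Language.mem_one]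
  have hR : ∀ w, w.length ≤ 4 * N + 1 → (([[]], n, w, [], u) ∈ v.2 ↔ Binds P 1 n w [] u) := by
    intro w hw
    rw [hT.mem_snd (by simp [hU]) (List.Sublist.refl n) (by simpa) (by omega), h1]
  simp only [typeWords, List.mem_filter, decide_eq_true_eq]
  rw [← hN, hv]
  simp only [List.headI, hU, ← FinAut.mem_language]
  constructor
  · rintro ⟨-, w, hw, hA, h⟩
    exact mem_typeOf_iff.2 ⟨w, hA, (hR w hw).1 h⟩
  · intro h
    obtain ⟨F, hF, hC, hcard⟩ := exists_coloring A
    replace hcard : Nat.card (F.level (3 * P.size)).κ ≤ N := by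
      rw [hcard, hN, inputColors, length_code, hc]
    obtain ⟨w, hA, hw, hb⟩ := exists_short_of_mem_typeOf hF hC hcard h
    exact ⟨by omega, w, by omega, hA, (hR w (by omega)).2 hb⟩

end Decision

-- Primitive recursiveness of the tables

namespace Primitive

variable {β γ δ : Type*} [Primcodable β] [Primcodable γ] [Primcodable δ]

/-- This and the following closure rules are stated pointwise, so that later goals can be decomposed
along their syntax by repeated `apply`. -/
theorem fst {f : β → γ × δ} (hf : Primrec f) : Primrec fun x => (f x).1 :=
  Primrec.fst.comp hf

theorem snd {f : β → γ × δ} (hf : Primrec f) : Primrec fun x => (f x).2 :=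
  Primrec.snd.comp hf

theorem pair {f : β → γ} {g : β → δ} (hf : Primrec f) (hg : Primrec g) :
    Primrec fun x => (f x, g x) :=
  hf.pair hg

theorem cons {f : β → γ} {g : β → List γ} (hf : Primrec f) (hg : Primrec g) :
    Primrec fun x => f x :: g x :=
  Primrec.list_cons.comp hf hg

theorem append {f g : β → List γ} (hf : Primrec f) (hg : Primrec g) :
    Primrec fun x => f x ++ g x :=
  Primrec.list_append.comp hf hg

theorem tail {f : β → List γ} (hf : Primrec f) : Primrec fun x => (f x).tail :=
  Primrec.list_tail.comp hf

theorem map {l : β → List γ} {f : β → γ → δ} (hl : Primrec l)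
    (hf : Primrec fun x : β × γ => f x.1 x.2) : Primrec fun x => (l x).map (f x) :=
  Primrec.list_map hl hf

theorem flatMap {l : β → List γ} {f : β → γ → List δ} (hl : Primrec l)
    (hf : Primrec fun x : β × γ => f x.1 x.2) : Primrec fun x => (l x).flatMap (f x) :=
  Primrec.list_flatMap hl hf

theorem filter {l : β → List γ} {p : β → γ → Prop} [∀ x, DecidablePred (p x)] (hl : Primrec l)
    (hp : PrimrecPred fun x : β × γ => p x.1 x.2) :
    Primrec fun x => (l x).filter fun y => p x y := by
  classical
  have h : PrimrecRel fun y x => p x y :=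
    (hp.comp (Primrec.snd.pair Primrec.fst) : PrimrecPred fun z : γ × β => p z.2 z.1)
  refine (h.listFilter.comp hl Primrec.id).of_eq fun x => ?_
  congr

theorem eq {f g : β → γ} (hf : Primrec f) (hg : Primrec g) : PrimrecPred fun x => f x = g x :=
  Primrec.eq.comp hf hg

theorem exists_mem {l : β → List γ} {p : β → γ → Prop} (hl : Primrec l)
    (hp : PrimrecPred fun x : β × γ => p x.1 x.2) : PrimrecPred fun x => ∃ y ∈ l x, p x y := by
  have h : PrimrecRel fun y x => p x y :=
    (hp.comp (Primrec.snd.pair Primrec.fst) : PrimrecPred fun z : γ × β => p z.2 z.1)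
  exact h.exists_mem_list.comp hl Primrec.id

theorem forall_mem {l : β → List γ} {p : β → γ → Prop} (hl : Primrec l)
    (hp : PrimrecPred fun x : β × γ => p x.1 x.2) : PrimrecPred fun x => ∀ y ∈ l x, p x y := by
  have h : PrimrecRel fun y x => p x y :=
    (hp.comp (Primrec.snd.pair Primrec.fst) : PrimrecPred fun z : γ × β => p z.2 z.1)
  exact h.forall_mem_list.comp hl Primrec.id

theorem mem {f : β → γ} {l : β → List γ} (hf : Primrec f) (hl : Primrec l) :
    PrimrecPred fun x => f x ∈ l x :=
  (exists_mem (p := fun x y => y = f x) hl (eq Primrec.snd (hf.comp Primrec.fst))).of_eq fun x => by simp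

theorem imp {p q : β → Prop} (hp : PrimrecPred p) (hq : PrimrecPred q) :
    PrimrecPred fun x => p x → q x :=
  (hp.not.or hq).of_eq fun x => by tauto

theorem iff {p q : β → Prop} (hp : PrimrecPred p) (hq : PrimrecPred q) :
    PrimrecPred fun x => (p x ↔ q x) :=
  ((imp hp hq).and (imp hq hp)).of_eq fun x => by tauto

theorem and {p q : β → Prop} (hp : PrimrecPred p) (hq : PrimrecPred q) :
    PrimrecPred fun x => p x ∧ q x :=
  hp.and hq

theorem or {p q : β → Prop} (hp : PrimrecPred p) (hq : PrimrecPred q) :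
    PrimrecPred fun x => p x ∨ q x :=
  hp.or hq

theorem not {p : β → Prop} (hp : PrimrecPred p) : PrimrecPred fun x => ¬ p x :=
  hp.not

theorem sublists' {l : β → List γ} (hl : Primrec l) : Primrec fun x => (l x).sublists' := by
  have h : Primrec (List.sublists' : List γ → List (List γ)) := by
    refine (Primrec.list_foldr (f := fun l => l) (g := fun _ => [[]])
      (h := fun _ (p : γ × List (List γ)) => p.2 ++ p.2.map (List.cons p.1))
      Primrec.id (Primrec.const _) ?_).of_eq fun l => ?_
    · refine append (snd Primrec.snd) (map (snd Primrec.snd) (cons ?_ Primrec.snd))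
      exact fst (snd Primrec.fst)
    · induction l with
      | nil => rfl
      | cons a l ih => rw [List.foldr_cons, ih, List.sublists'_cons]
  exact h.comp hl

theorem pow {f g : β → ℕ} (hf : Primrec f) (hg : Primrec g) : Primrec fun x => f x ^ g x := by
  refine (Primrec.nat_rec' hg (Primrec.const 1)
    (h := fun x p => p.2 * f x) ?_).of_eq fun x => ?_
  · exact Primrec.nat_mul.comp (snd Primrec.snd) (hf.comp Primrec.fst)
  · induction g x with
    | zero => rfl
    | succ n ih => rw [pow_succ, ← ih]

theorem head? {f : β → List γ} (hf : Primrec f) : Primrec fun x => (f x).head? :=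
  Primrec.list_head?.comp hf

variable [Primcodable α]

theorem map_sym {f : β → List α} (hf : Primrec f) : Primrec fun x => (f x).map Label.sym :=
  map hf (((Primrec.of_equiv_symm (e := Label.equivSum α)).comp Primrec.sumInr).comp Primrec.snd)

open scoped Classical in
theorem mulList {U L K : β → List (List α)} (hU : Primrec U) (hL : Primrec L) (hK : Primrec K) :
    Primrec fun x => UniqueMatching.mulList (U x) (L x) (K x) := by
  refine filter hU (exists_mem (hL.comp Primrec.fst) (exists_mem
    ((hK.comp Primrec.fst).comp Primrec.fst) (eq (append ?_ Primrec.snd) ?_)))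
  · exact snd Primrec.fst
  · exact snd (fst Primrec.fst)

open scoped Classical in
theorem wordList : Primrec fun x : List (List α) × Label α × List (List α) × List (List α) =>
    UniqueMatching.wordList x.1 x.2.1 x.2.2.1 x.2.2.2 := by
  refine filter Primrec.fst ?_
  unfold IsWord
  repeat' with_reducible first
    | exact Primrec.const _ | exact Primrec.fst | exact Primrec.snd
    | apply or | apply and | apply not | apply exists_mem | apply forall_mem | apply eq | apply mem
    | apply imp | apply map_sym | apply sublists' | apply append | apply cons | apply fst
    | apply snd

theorem allBindings : Primrec fun x : List (List α) × Node =>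
    UniqueMatching.allBindings x.1 x.2 := by
  unfold UniqueMatching.allBindings
  repeat' with_reducible first
    | exact Primrec.const _ | exact Primrec.fst | exact Primrec.snd
    | apply flatMap | apply map | apply sublists' | apply fst | apply snd | apply pair

theorem isBinding : PrimrecPred
    fun x : (List (List α) × Label α × List (List α) × Table α × Table α) × Binding α =>
      IsBinding x.1.1 x.1.2.1 x.1.2.2.1 x.1.2.2.2.1.1 x.1.2.2.2.2.1 x.1.2.2.2.1.2 x.1.2.2.2.2.2
        x.2.1 x.2.2.1 x.2.2.2.1 x.2.2.2.2.1 x.2.2.2.2.2 := by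
  unfold IsBinding
  refine or ?_ (or ?_ (or ?_ (or ?_ ?_)))
  all_goals
    repeat' with_reducible first
      | exact Primrec.const _ | exact Primrec.fst | exact Primrec.snd
      | apply or | apply and | apply not | apply exists_mem | apply eq | apply mem
      | apply mulList | apply map_sym | apply append | apply cons | apply tail
      | apply head? | apply fst | apply snd | apply pair

open scoped Classical in
theorem table : Primrec fun x : List (List α) × Node × Label α × Table α × Table α =>
    UniqueMatching.table x.1 x.2.1 x.2.2.1 x.2.2.2.1 x.2.2.2.2 := by
  have hL : Primrec fun x : List (List α) × Node × Label α × Table α × Table α =>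
      UniqueMatching.wordList x.1 x.2.2.1 x.2.2.2.1.1 x.2.2.2.2.1 := by
    refine wordList.comp (pair Primrec.fst (pair ?_ (pair ?_ ?_))) <;>
      repeat' with_reducible first | exact Primrec.snd | apply fst | apply snd
  have hctx : Primrec fun x : List (List α) × Node × Label α × Table α × Table α =>
      (x.1, x.2.2.1, UniqueMatching.wordList x.1 x.2.2.1 x.2.2.2.1.1 x.2.2.2.2.1, x.2.2.2) :=
    pair Primrec.fst (pair (fst (snd Primrec.snd)) (pair hL (snd (snd Primrec.snd))))
  have hall : Primrec fun x : List (List α) × Node × Label α × Table α × Table α =>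
      UniqueMatching.allBindings x.1 x.2.1 :=
    allBindings.comp (pair Primrec.fst (fst Primrec.snd))
  have hbind := isBinding.comp (pair (hctx.comp Primrec.fst) Primrec.snd)
  exact pair hL (filter hall hbind)

end Primitive

-- Reconstructing an automaton from short words

open scoped Classical in
/-- An automaton for a language of which the short words are given: its states are (the codes of)
the words of length at most `N`, and it passes from a word to all words with the same
continuations of length at most `N`. -/
noncomputable def residualAut [Encodable α] (letters : List α) (N : ℕ) (T : List (List α)) :
    FinAut α where
  init := [Encodable.encode ([] : List α)]
  final := ((shortWords letters N).filter (· ∈ T)).map Encodable.encode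
  trans := (shortWords letters N).flatMap fun x => letters.flatMap fun a =>
    ((shortWords letters N).filter fun y =>
      ∀ v ∈ shortWords letters N, (x ++ a :: v ∈ T ↔ y ++ v ∈ T)).map fun y =>
      (Encodable.encode x, a, Encodable.encode y)

/-- Residuals are determined by continuations of length at most `N`, since every continuation has
the colour of such a word. A transition test appends a letter and a continuation to a state, which
explains the length `2 * N + 1`. All states reached by a word have its residual, and some short word
of its colour is among them. -/
theorem language_residualAut [Encodable α] {letters : List α} (hl : ∀ a, a ∈ letters) {N : ℕ}
    {F : Coloring α} (hN : Nat.card F.κ ≤ N) {X : Language α} (hX : F.Respects X)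
    {T : List (List α)} (hT : ∀ w, w.length ≤ 2 * N + 1 → (w ∈ T ↔ w ∈ X)) :
    (residualAut letters N T).language = X := by
  set A := residualAut letters N T with hA
  have hX' : ∀ u v, F.color u = F.color v → (u ∈ X ↔ v ∈ X) :=
    fun u v h => ⟨fun hu => hX h hu, fun hv => hX h.symm hv⟩
  have htrans : ∀ p a q, (p, a, q) ∈ A.trans ↔ ∃ x y : List α, x.length ≤ N ∧ y.length ≤ N ∧
      p = Encodable.encode x ∧ q = Encodable.encode y ∧ ∀ v, (x ++ a :: v ∈ X ↔ y ++ v ∈ X) := by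
    intro p a q
    have hext : ∀ x y : List α, x.length ≤ N → y.length ≤ N →
        ((∀ v ∈ shortWords letters N, (x ++ a :: v ∈ T ↔ y ++ v ∈ T)) ↔
          ∀ v, (x ++ a :: v ∈ X ↔ y ++ v ∈ X)) := by
      intro x y hx hy
      constructor
      · intro h v
        -- An arbitrary continuation is exchanged for a short one of the same colour, to which the
        -- finite test applies.
        obtain ⟨v', hv, hv'⟩ := F.exists_short hN v
        have := h v' ((mem_shortWords hl).2 hv')
        rw [hT _ (by simp; omega), hT _ (by simp; omega)] at this
        exact (hX' (x ++ ([a] ++ v')) (x ++ ([a] ++ v)) (F.append rfl (F.append rfl hv))).symm.trans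
          (this.trans (hX' (y ++ v') (y ++ v) (F.append rfl hv)))
      · intro h v hv
        rw [mem_shortWords hl] at hv
        rw [hT _ (by simp; omega), hT _ (by simp; omega)]
        exact h v
    simp only [hA, residualAut, List.mem_flatMap, List.mem_map, List.mem_filter,
      decide_eq_true_eq, mem_shortWords hl, Prod.mk.injEq]
    constructor
    · rintro ⟨x, hx, b, -, y, ⟨hy, h⟩, rfl, rfl, rfl⟩
      simp only [← mem_shortWords hl] at h
      exact ⟨x, y, hx, hy, rfl, rfl, (hext x y hx hy).1 h⟩
    · rintro ⟨x, y, hx, hy, rfl, rfl, h⟩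
      have := (hext x y hx hy).2 h
      simp only [mem_shortWords hl] at this
      exact ⟨x, hx, a, hl a, y, ⟨hy, this⟩, rfl, rfl, rfl⟩
  have hfinal : ∀ y : List α, y.length ≤ N → (Encodable.encode y ∈ A.final ↔ y ∈ X) := by
    intro y hy
    simp only [hA, residualAut, List.mem_map, List.mem_filter, decide_eq_true_eq,
      mem_shortWords hl, Encodable.encode_inj, exists_eq_right, hy, true_and]
    exact hT y (by omega)
  have hsound : ∀ w q, q ∈ A.toNFA.eval w →
      ∃ y : List α, y.length ≤ N ∧ q = Encodable.encode y ∧ ∀ v, (w ++ v ∈ X ↔ y ++ v ∈ X) := by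
    intro w
    induction w using List.reverseRecOn with
    | nil =>
      intro q hq
      exact ⟨[], Nat.zero_le _, List.mem_singleton.1 hq, fun v => Iff.rfl⟩
    | append_singleton w a ih =>
      intro q hq
      rw [NFA.eval_append_singleton, NFA.mem_stepSet] at hq
      obtain ⟨p, hp, hq⟩ := hq
      obtain ⟨x', y, hx', hy, rfl, rfl, h⟩ := (htrans _ _ _).1 hq
      obtain ⟨x, hx, he, hwx⟩ := ih _ hp
      obtain rfl := Encodable.encode_injective he
      exact ⟨y, hy, rfl, fun v => by rw [List.append_assoc, hwx, ← h]; rfl⟩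
  have hcomplete : ∀ w, ∃ y : List α, y.length ≤ N ∧ F.color y = F.color w ∧
      Encodable.encode y ∈ A.toNFA.eval w := by
    intro w
    induction w using List.reverseRecOn with
    | nil => exact ⟨[], Nat.zero_le _, rfl, List.mem_singleton.2 rfl⟩
    | append_singleton w a ih =>
      obtain ⟨x, hx, hc, he⟩ := ih
      obtain ⟨y, hy, hyl⟩ := F.exists_short hN (w ++ [a])
      refine ⟨y, hyl, hy, ?_⟩
      rw [NFA.eval_append_singleton, NFA.mem_stepSet]
      refine ⟨_, he, (htrans _ _ _).2 ⟨x, y, hx, hyl, rfl, rfl, fun v => hX' _ _ ?_⟩⟩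
      rw [F.append hy rfl, List.append_cons]
      exact F.append (F.append hc rfl) rfl
  ext w
  rw [FinAut.language, NFA.mem_accepts]
  constructor
  · rintro ⟨q, hq, hw⟩
    obtain ⟨y, hy, rfl, h⟩ := hsound w q hw
    have := (hfinal y hy).1 hq
    simpa using (h []).2 (by simpa using this)
  · intro hw
    obtain ⟨y, hy, hc, he⟩ := hcomplete w
    exact ⟨_, (hfinal y hy).2 ((hX' _ _ hc).2 hw), he⟩

/-- The automaton for the type of a node. -/
noncomputable def typeAut [Encodable α] (letters : List α)
    (x : List (Label α) × Node × FinAut α) : FinAut α :=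
  residualAut letters (inputColors letters x.1 x.2.2) (typeWords letters x.1 x.2.1 x.2.2)

theorem language_typeAut [Encodable α] [Finite α] {letters : List α} (hl : ∀ a, a ∈ letters)
    (hc : letters.length = Nat.card α) (P : Pattern α) (n : Node) (A : FinAut α) :
    (typeAut letters (P.code, n, A)).language = typeOf n P A.language := by
  obtain ⟨F, hF, hC, hcard⟩ := exists_coloring A
  refine language_residualAut hl (F := F.level (3 * P.size)) ?_ (respects_typeOf hF hC n)
    fun w hw => mem_typeWords hl hc hw
  rw [hcard, inputColors, length_code, hc]

-- Primitive recursiveness of the whole construction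

namespace Primitive

variable [Primcodable α]

theorem shortWords (letters : List α) : Primrec (UniqueMatching.shortWords letters) := by
  refine (Primrec.nat_rec₁ [[]] (f := fun _ S => [] :: S.flatMap fun w =>
    letters.map fun a => a :: w) ?_).of_eq fun n => ?_
  · exact cons (Primrec.const _) (flatMap Primrec.snd
      (map (Primrec.const _) (cons Primrec.snd (snd Primrec.fst))))
  · induction n with
    | zero => rfl
    | succ n ih =>
      rw [UniqueMatching.shortWords, ← ih]

theorem init : Primrec (FinAut.init : FinAut α → List ℕ) :=
  fst (Primrec.of_equiv (e := FinAut.equivProd α))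

theorem final : Primrec (FinAut.final : FinAut α → List ℕ) :=
  fst (snd (Primrec.of_equiv (e := FinAut.equivProd α)))

theorem trans : Primrec (FinAut.trans : FinAut α → List (ℕ × α × ℕ)) :=
  snd (snd (Primrec.of_equiv (e := FinAut.equivProd α)))

open scoped Classical in
theorem run : Primrec fun x : FinAut α × List α => x.1.run x.2 := by
  refine Primrec.list_foldl (h := fun x (p : List ℕ × α) =>
    (x.1.trans.filter fun t : ℕ × α × ℕ => t.2.1 = p.2 ∧ t.1 ∈ p.1).map fun t => t.2.2)
    Primrec.snd (init.comp Primrec.fst) ?_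
  refine map (filter (trans.comp (fst Primrec.fst)) (and (eq ?_ ?_) (mem ?_ ?_))) ?_ <;>
    repeat' with_reducible first | exact Primrec.fst | exact Primrec.snd | apply fst | apply snd

theorem refineCard : Primrec UniqueMatching.refineCard := by
  refine Primrec.nat_mul.comp Primrec.id
    (pow (pow (Primrec.const 2) ?_) (pow (Primrec.const 2) Primrec.id))
  exact Primrec.nat_mul.comp Primrec.id Primrec.id

theorem inputColors (letters : List α) : Primrec fun x : List (Label α) × FinAut α =>
    UniqueMatching.inputColors letters x.1 x.2 := by
  have hq : Primrec fun x : List (Label α) × FinAut α => x.2.states.length := by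
    refine Primrec.list_length.comp (append (init.comp Primrec.snd)
      (map (trans.comp Primrec.snd) ?_))
    exact snd (snd Primrec.snd)
  have h2 := pow (Primrec.const 2) hq
  refine Primrec.nat_iterate (h := fun _ => UniqueMatching.refineCard)
    (Primrec.nat_mul.comp (Primrec.const 3) (Primrec.list_length.comp Primrec.fst))
    (Primrec.nat_mul.comp (Primrec.const _) (pow h2 h2)) (refineCard.comp Primrec.snd)

open scoped Classical in
theorem evalStep : Primrec
    fun x : (List (List α) × Node) × Label α × List (Table α) =>
      UniqueMatching.evalStep x.1.1 x.1.2 x.2.1 x.2.2 := by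
  have hst : Primrec fun x : (List (List α) × Node) × Label α × List (Table α) => x.2.2 :=
    snd Primrec.snd
  have hl : Primrec fun x : (List (List α) × Node) × Label α × List (Table α) => x.2.1 :=
    fst Primrec.snd
  refine cons ?_ (Primrec.ite (eq hl (Primrec.const _)) (tail hst)
    (Primrec.ite (or (eq hl (Primrec.const _)) (eq hl (Primrec.const _))) (tail (tail hst)) hst))
  exact table.comp (pair (fst Primrec.fst) (pair (snd Primrec.fst) (pair hl
    (pair (Primrec.list_headI.comp hst) (Primrec.list_headI.comp (tail hst))))))

theorem evalCode {β : Type*} [Primcodable β] {U : β → List (List α)} {n : β → Node}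
    {c : β → List (Label α)} (hU : Primrec U) (hn : Primrec n) (hc : Primrec c) :
    Primrec fun x => ((c x).foldr (UniqueMatching.evalStep (U x) (n x)) []).headI.2 := by
  have h : Primrec₂ fun (x : β) (p : Label α × List (Table α)) =>
      UniqueMatching.evalStep (U x) (n x) p.1 p.2 :=
    evalStep.comp (pair (pair (hU.comp Primrec.fst) (hn.comp Primrec.fst)) Primrec.snd)
  exact snd (Primrec.list_headI.comp (Primrec.list_foldr hc (Primrec.const []) h))

open scoped Classical in
theorem filterBound {β : Type*} [Primcodable β] {U : β → List (List α)} {n : β → Node}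
    {A : β → FinAut α} {R : β → List (Binding α)} (hU : Primrec U) (hn : Primrec n)
    (hA : Primrec A) (hR : Primrec R) : Primrec fun x => (U x).filter fun u =>
      ∃ w ∈ U x, (∃ q ∈ (A x).final, q ∈ (A x).run w) ∧ ([[]], n x, w, [], u) ∈ R x := by
  refine filter hU (exists_mem (hU.comp Primrec.fst) (and (exists_mem ?_ (mem Primrec.snd ?_))
    (mem ?_ ((hR.comp Primrec.fst).comp Primrec.fst))))
  · exact final.comp (hA.comp (fst Primrec.fst))
  · exact run.comp (pair (hA.comp (fst (fst Primrec.fst))) (snd Primrec.fst))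
  · exact pair (Primrec.const _) (pair (hn.comp (fst Primrec.fst))
      (pair Primrec.snd (pair (Primrec.const _) (snd Primrec.fst))))

theorem typeWords (letters : List α) : Primrec fun x : List (Label α) × Node × FinAut α =>
    UniqueMatching.typeWords letters x.1 x.2.1 x.2.2 := by
  have hN : Primrec fun x : List (Label α) × Node × FinAut α =>
      UniqueMatching.inputColors letters x.1 x.2.2 :=
    (inputColors letters).comp (pair Primrec.fst (snd Primrec.snd))
  have hU : Primrec fun x : List (Label α) × Node × FinAut α =>
      UniqueMatching.shortWords letters
        (4 * UniqueMatching.inputColors letters x.1 x.2.2 + 1) :=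
    (shortWords letters).comp (Primrec.succ.comp (Primrec.nat_mul.comp (Primrec.const 4) hN))
  exact filterBound hU (fst Primrec.snd) (snd Primrec.snd)
    (evalCode hU (fst Primrec.snd) Primrec.fst)

open scoped Classical in
theorem residualAut (letters : List α) : Primrec fun x : ℕ × List (List α) =>
    UniqueMatching.residualAut letters x.1 x.2 := by
  have hS : Primrec fun x : ℕ × List (List α) => UniqueMatching.shortWords letters x.1 :=
    (shortWords letters).comp Primrec.fst
  have hfinal : Primrec fun x : ℕ × List (List α) =>
      ((UniqueMatching.shortWords letters x.1).filter (· ∈ x.2)).map Encodable.encode :=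
    map (filter hS (mem Primrec.snd (snd Primrec.fst))) (Primrec.encode.comp Primrec.snd)
  have htrans : Primrec fun x : ℕ × List (List α) =>
      (UniqueMatching.shortWords letters x.1).flatMap fun z => letters.flatMap fun a =>
        ((UniqueMatching.shortWords letters x.1).filter fun y =>
          ∀ v ∈ UniqueMatching.shortWords letters x.1, (z ++ a :: v ∈ x.2 ↔ y ++ v ∈ x.2)).map
          fun y => (Encodable.encode z, a, Encodable.encode y) := by
    have h₁ := (hS.comp (Primrec.fst (β := List α))).comp (Primrec.fst (β := α))
    refine flatMap hS (flatMap (Primrec.const _) (map (filter h₁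
      (forall_mem (h₁.comp Primrec.fst) (iff (mem (append ?_ (cons ?_ Primrec.snd)) ?_)
        (mem (append ?_ Primrec.snd) ?_)))) (pair (Primrec.encode.comp ?_) (pair ?_
          (Primrec.encode.comp Primrec.snd))))) <;>
      repeat' with_reducible first | exact Primrec.fst | exact Primrec.snd | apply fst | apply snd
  exact (Primrec.of_equiv_symm (e := FinAut.equivProd α)).comp
    (pair (Primrec.const _) (pair hfinal htrans))

theorem typeAut (letters : List α) : Primrec (UniqueMatching.typeAut letters) :=
  (residualAut letters).comp (pair
    ((inputColors letters).comp (pair Primrec.fst (snd Primrec.snd))) (typeWords letters))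

end Primitive

end UniqueMatching

theorem theorem2 {α : Type*} [Finite α] [Primcodable α] :
    (∀ (P : UniqueMatching.Pattern α) (n : UniqueMatching.Node), n ∈ P.bn →
      ∀ C : Language α, C.IsRegular → (UniqueMatching.typeOf n P C).IsRegular) ∧
    (∃ f : List (UniqueMatching.Label α) × UniqueMatching.Node × UniqueMatching.FinAut α →
        UniqueMatching.FinAut α,
      Computable f ∧
      ∀ (P : UniqueMatching.Pattern α) (n : UniqueMatching.Node) (A : UniqueMatching.FinAut α),
        n ∈ P.bn →
        (f (P.code, n, A)).language = UniqueMatching.typeOf n P A.language) := by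
  refine ⟨fun P n _ C hC => UniqueMatching.isRegular_typeOf P n hC, ?_⟩
  have := Fintype.ofFinite α
  -- The list of letters is a constant of the algorithm, so it does not matter how it is obtained.
  refine ⟨_, (UniqueMatching.Primitive.typeAut (Finset.univ : Finset α).toList).to_comp,
    fun P n A _ => UniqueMatching.language_typeAut (by simp) (by simp) P n A⟩
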